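/- Let $k$ be a field and $V$ a $k$-vector space. Two subspaces $A,B$ of a vector space are commensurable, $A\sim B$, if $\dim_k (A+B)/(A\cap B)<\infty$. For a subspace $A\subseteq V$ let $\mathrm{GL}(V,A)$ be the group of all $f\in\mathrm{Aut}_k(V)$ with $f(A)\sim A$, and for $f\in \mathrm{GL}(V,A)$ put $$i(f,A,V)=\dim_k\big(A/(A\cap fA)\big)-\dim_k\big(fA/(A\cap fA)\big)\in\mathbb Z .$$ Let $1\to k^\times\to\widetilde{\mathrm{GL}}(V,A)\to \mathrm{GL}(V,A)\to 1$ be the determinantal central extension: the elements of $\widetilde{\mathrm{GL}}(V,A)$ are the pairs $(f,a)$ with $f\in \mathrm{GL}(V,A)$ and $a$ a nonzero element of the relative determinant line $(A|fA)$, where $(B|C)=\mathrm{Hom}_k\big(\bigwedge^{\max}(C/N),\bigwedge^{\max}(B/N)\big)$ for any $N\subseteq B\cap C$ of finite codimension in $B$ and $C$ (the choice of $N$ being immaterial up to canonical isomorphism), and $(f,a)(g,b)=(fg,a\circ f_*b)$. For commuting $\sigma,\tau\in \mathrm{GL}(V,A)$ let $\{\sigma,\tau\}^V_A=\tilde\sigma\tilde\tau\tilde\sigma^{-1}\tilde\tau^{-1}\in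 k^\times$, where $\tilde\sigma,\tilde\tau$ are any lifts of $\sigma,\tau$, and let $$\langle\sigma,\tau\rangle^V_A=(-1)^{i(\sigma,A,V)\,i(\tau,A,V)}\{\sigma,\tau\}^V_A .$$ If $G$ is a commutative group and $\varphi\colon k^\times\to G$ is a group morphism, let $\{\sigma,\tau\}^V_{A,\varphi}\in G$ be the commutator of lifts of $\sigma,\tau$ to the central extension of $\mathrm{GL}(V,A)$ by $G$ obtained by pushing forward the determinantal one along $\varphi$. Let $\{V_i\}_{i\in I}$ be a family of subspaces of $V$ and let $\mathrm{GL}(V,\{V_i\}_{i\in I})$ be the group of all $\sigma\in\mathrm{Aut}_k(V)$ such that $\sigma\in\mathrm{GL}(V,V_i)$ for all $i$ and $\sigma(V_i)=V_i$ for almost all $i$. Let $\{W_i\}_{i\in I}$ be a second family of subspaces of $V$ such that $V_i\subseteq W_i$ for all $i\in I$ and $\sigma(W_i)=W_i$ for all $i \in I$ and every $\sigma\in\mathrm{GL}(V,\{V_i\}_{i\in I})$. Put $A_I=\prod_{i\in I}V_i\subseteq W_I=\prod_{i\in I}W_i$; then every $\sigma\in\mathrm{GL}(V,\{V_i\}_{i\in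 I})$ acts by restriction on each $W_i$ as an element of $\mathrm{GL}(W_i,V_i)$ and diagonally on $W_I$ as an element of $\mathrm{GL}(W_I,A_I)$. Let $\sigma,\tau\in \mathrm{GL}(V,\{V_i\}_{i\in I})$ commute, let $G$ be a commutative group and $\varphi\colon k^\times\to G$ a group morphism. Then only finitely many of the elements $\varphi(-1)^{i(\sigma,V_i,W_i)\,i(\tau,V_i,W_i)}\cdot\{\sigma,\tau\}^{W_i}_{V_i,\varphi}$, $i\in I$, are different from $1$, and $$\varphi\big(\langle\sigma,\tau\rangle^{W_I}_{A_I}\big)=\prod_{i\in I}\varphi(-1)^{i(\sigma,V_i,W_i)\,i(\tau,V_i,W_i)}\cdot\{\sigma,\tau\}^{W_i}_{V_i,\varphi} .$$ Accordingly, if $\{\sigma,\tau\}^{W_I}_{A_I}=1$ and $i(\sigma,A_I,W_I)=0$, then $$\prod_{i\in I}\varphi(-1)^{i(\sigma,V_i,W_i)\,i(\tau,V_i,W_i)}\cdot\{\sigma,\tau\}^{W_i}_{V_i,\varphi}=1 .$$ -/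

import Mathlib

namespace TameSymbol

universe u v w

section Determinants

variable {k : Type u} [Field k] {V : Type v} [AddCommGroup V] [Module k V]

/-- Two subspaces are commensurable when `(A + B) / (A ∩ B)` is finite dimensional. -/
def Commensurable (A B : Submodule k V) : Prop :=
  FiniteDimensional k (↥(A ⊔ B) ⧸ (A ⊓ B).submoduleOf (A ⊔ B))

/-- `l` is a (finite, ordered) list of vectors whose classes form a basis of `B / N`
(in particular `N ≤ B`, and `B / N` is finite dimensional). -/
structure IsFrame (N B : Submodule k V) (l : List V) : Prop where
  indep : LinearIndependent k (fun i : Fin l.length => N.mkQ (l.get i))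
  span : Submodule.span k {x | x ∈ l} ⊔ N = B

/-- The wedge product, in the exterior algebra of `V / N`, of the classes of the vectors of `l`.
When `l` is a frame of `B / N` this is a generator of the line `det (B / N)`. -/
noncomputable def wedge (N : Submodule k V) (l : List V) : ExteriorAlgebra k (V ⧸ N) :=
  (l.map (fun x => ExteriorAlgebra.ι k (N.mkQ x))).prod

theorem wedge_append (N : Submodule k V) (l l' : List V) :
    wedge N (l ++ l') = wedge N l * wedge N l' := by
  simp [wedge]

theorem wedge_nil (N : Submodule k V) : wedge N [] = 1 := by simp [wedge]

theorem wedge_cons (N : Submodule k V) (x : V) (l : List V) :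
    wedge N (x :: l) = ExteriorAlgebra.ι k (N.mkQ x) * wedge N l := by simp [wedge]

theorem wedge_eq_iMulti (N : Submodule k V) (l : List V) :
    wedge N l = ExteriorAlgebra.ιMulti k l.length (fun i : Fin l.length => N.mkQ (l.get i)) := by
  rw [ExteriorAlgebra.ιMulti_apply, wedge]
  congr 1
  apply List.ext_get <;> simp

theorem IsFrame.le {N B : Submodule k V} {l : List V} (h : IsFrame N B l) : N ≤ B :=
  h.span ▸ le_sup_right

theorem IsFrame.mem {N B : Submodule k V} {l : List V} (h : IsFrame N B l) {x : V} (hx : x ∈ l) :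
    x ∈ B :=
  h.span ▸ (le_sup_left (a := Submodule.span k {x | x ∈ l}) (b := N)) (Submodule.subset_span hx)

theorem IsFrame.span_range {N B : Submodule k V} {l : List V} (h : IsFrame N B l) :
    Submodule.span k (Set.range (fun i : Fin l.length => N.mkQ (l.get i))) = B.map N.mkQ := by
  have : Set.range (fun i : Fin l.length => N.mkQ (l.get i)) = N.mkQ '' {x | x ∈ l} := by
    ext y
    simp only [Set.mem_range, Set.mem_image, Set.mem_ofPred_eq]
    constructor
    · rintro ⟨i, rfl⟩
      exact ⟨_, List.get_mem l i, rfl⟩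
    · rintro ⟨x, hx, rfl⟩
      obtain ⟨i, rfl⟩ := List.get_of_mem hx
      exact ⟨i, rfl⟩
  rw [this, Submodule.span_image, ← h.span, Submodule.map_sup]
  simp

/-- The basis of `B / N` given by a frame. -/
noncomputable def IsFrame.basis {N B : Submodule k V} {l : List V} (h : IsFrame N B l) :
    Module.Basis (Fin l.length) k ↥(B.map N.mkQ) :=
  (Module.Basis.span h.indep).map (LinearEquiv.ofEq _ _ h.span_range)

theorem IsFrame.basis_apply {N B : Submodule k V} {l : List V} (h : IsFrame N B l)
    (i : Fin l.length) : (h.basis i : V ⧸ N) = N.mkQ (l.get i) := by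
  rw [IsFrame.basis, Module.Basis.map_apply, LinearEquiv.coe_ofEq_apply,
    Module.Basis.span_apply]

theorem IsFrame.length_eq {N B : Submodule k V} {l l' : List V} (h : IsFrame N B l)
    (h' : IsFrame N B l') : l.length = l'.length := by
  have := Module.finrank_eq_card_basis h.basis
  have h2 := Module.finrank_eq_card_basis h'.basis
  simp_all

theorem alternating_eq_det_smul {n : ℕ} {P M : Type*} [AddCommGroup P] [Module k P]
    [AddCommGroup M] [Module k M] (e : Module.Basis (Fin n) k P) (f : P [⋀^Fin n]→ₗ[k] M)
    (v : Fin n → P) : f v = e.det v • f e := by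
  have : f = (LinearMap.toSpanSingleton k M (f e)).compAlternatingMap e.det := by
    refine Module.Basis.ext_alternating e fun i h => ?_
    let σ : Equiv.Perm (Fin n) := Equiv.ofBijective i (Finite.injective_iff_bijective.1 h)
    change f (e ∘ σ) = LinearMap.toSpanSingleton k M (f e) (e.det (e ∘ σ))
    rw [AlternatingMap.map_perm, AlternatingMap.map_perm, Module.Basis.det_self]
    rcases Int.units_eq_one_or (Equiv.Perm.sign σ) with h | h <;> simp [h]
  conv_lhs => rw [this]
  simp

theorem IsFrame.wedge_ne_zero {N B : Submodule k V} {l : List V} (h : IsFrame N B l) :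
    wedge N l ≠ 0 := by
  obtain ⟨p, hp⟩ := (B.map N.mkQ).subtype.exists_leftInverse_of_injective
    (Submodule.ker_subtype _)
  intro h0
  rw [wedge_eq_iMulti] at h0
  have h1 := congrArg (ExteriorAlgebra.liftAlternating (R := k)
    (Function.update (fun i => (0 : (V ⧸ N) [⋀^Fin i]→ₗ[k] k)) l.length
      (h.basis.det.compLinearMap p))) h0
  rw [ExteriorAlgebra.liftAlternating_apply_ιMulti, Function.update_self, map_zero,
    AlternatingMap.compLinearMap_apply] at h1
  have h2 : (p ∘ fun i : Fin l.length => N.mkQ (l.get i)) = h.basis := by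
    funext i
    have := LinearMap.congr_fun hp (h.basis i)
    simpa [h.basis_apply i] using this
  have h3 : (fun i : Fin l.length => p (N.mkQ (l.get i))) = h.basis := h2
  rw [h3, Module.Basis.det_self] at h1
  exact one_ne_zero h1

/-- Two frames of `B / N` have proportional wedge products. -/
theorem IsFrame.exists_smul {N B : Submodule k V} {l l' : List V} (h : IsFrame N B l)
    (h' : IsFrame N B l') : ∃ r : kˣ, wedge N l' = r • wedge N l := by
  have key : ∀ n (hn : n = l'.length) (e : Module.Basis (Fin n) k ↥(B.map N.mkQ)),
      wedge N l' = e.det (fun i => h'.basis (i.cast hn)) •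
        ExteriorAlgebra.ιMulti k n (fun i => (e i : V ⧸ N)) := by
    intro n hn e
    subst hn
    have := alternating_eq_det_smul e
      ((ExteriorAlgebra.ιMulti k l'.length).compLinearMap (B.map N.mkQ).subtype) h'.basis
    rw [AlternatingMap.compLinearMap_apply, AlternatingMap.compLinearMap_apply] at this
    simp only [Submodule.subtype_apply, h'.basis_apply] at this
    rw [wedge_eq_iMulti]
    exact this
  have h1 := key _ (h.length_eq h') h.basis
  simp only [h.basis_apply] at h1
  rw [← wedge_eq_iMulti] at h1
  have hne : h.basis.det (fun i => h'.basis (i.cast (h.length_eq h'))) ≠ 0 := by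
    intro h0
    rw [h0, zero_smul] at h1
    exact h'.wedge_ne_zero h1
  exact ⟨Units.mk0 _ hne, h1⟩

theorem smul_wedge_inj {N B : Submodule k V} {l : List V} (h : IsFrame N B l) {r s : kˣ}
    (hrs : r • wedge N l = s • wedge N l) : r = s := by
  have : (r : k) • wedge N l = (s : k) • wedge N l := hrs
  exact Units.ext (smul_left_injective k h.wedge_ne_zero this)

/-- If left multiplication by `P` kills the classes of `N` in `V / M`, then `P * wedge M c`
depends linearly on `wedge N c` only. -/
theorem exists_mul_wedge {M N : Submodule k V} (hMN : M ≤ N) :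
    ∃ F : ExteriorAlgebra k (V ⧸ N) →ₗ[k] ExteriorAlgebra k (V ⧸ M),
      ∀ P : ExteriorAlgebra k (V ⧸ M),
        (∀ x ∈ N, P * ExteriorAlgebra.ι k (M.mkQ x) = 0) →
        ∀ c : List V, P * wedge M c = P * F (wedge N c) := by
  obtain ⟨s, hs⟩ := (Submodule.factor hMN).exists_rightInverse_of_surjective
    (LinearMap.range_eq_top.2 (Submodule.factor_surjective hMN))
  refine ⟨(ExteriorAlgebra.map s).toLinearMap, fun P hP c => ?_⟩
  induction c generalizing P with
  | nil => simp [wedge_nil]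
  | cons x c ih =>
    obtain ⟨y, hy⟩ := N.mkQ_surjective (N.mkQ x)
    obtain ⟨z, hz⟩ := M.mkQ_surjective (s (N.mkQ x))
    have hzx : z - x ∈ N := by
      have h1 := LinearMap.congr_fun hs (N.mkQ x)
      rw [LinearMap.comp_apply, ← hz] at h1
      have h2 : N.mkQ z = N.mkQ x := by simpa using h1
      rwa [Submodule.mkQ_apply, Submodule.mkQ_apply, Submodule.Quotient.eq] at h2
    have h0 := hP _ hzx
    rw [map_sub, map_sub, mul_sub, sub_eq_zero] at h0
    rw [wedge_cons, wedge_cons, AlgHom.toLinearMap_apply, map_mul, ExteriorAlgebra.map_apply_ι,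
      ← hz, ← mul_assoc, ← mul_assoc, h0]
    refine ih _ fun w hw => ?_
    have h3 := ExteriorAlgebra.ι_add_mul_swap (R := k) (M.mkQ x) (M.mkQ w)
    rw [mul_assoc, eq_neg_of_add_eq_zero_left h3, mul_neg, ← mul_assoc, hP w hw, zero_mul,
      neg_zero]

theorem wedge_mul_eq_zero {M N : Submodule k V} {u : List V} (hu : IsFrame M N u) {x : V}
    (hx : x ∈ N) : wedge M u * ExteriorAlgebra.ι k (M.mkQ x) = 0 := by
  have key : ∀ (u : List V) (y : V), y ∈ u →
      wedge M u * ExteriorAlgebra.ι k (M.mkQ y) = 0 := by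
    intro u
    induction u with
    | nil => simp
    | cons a u ih =>
      intro y hy
      by_cases hyu : y ∈ u
      · rw [wedge_cons, mul_assoc, ih y hyu, mul_zero]
      · have hya : y = a := by simpa [hyu] using hy
        subst hya
        have swap : ∀ u : List V, ∃ e : k, wedge M u * ExteriorAlgebra.ι k (M.mkQ y)
            = e • (ExteriorAlgebra.ι k (M.mkQ y) * wedge M u) := by
          intro u
          induction u with
          | nil => exact ⟨1, by simp [wedge_nil]⟩
          | cons b u ih =>
            obtain ⟨e, he⟩ := ih
            refine ⟨-e, ?_⟩
            have h3 := ExteriorAlgebra.ι_add_mul_swap (R := k) (M.mkQ b) (M.mkQ y)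
            rw [wedge_cons, mul_assoc, he, mul_smul_comm, ← mul_assoc, ← mul_assoc,
              eq_neg_of_add_eq_zero_left h3, neg_mul, smul_neg, neg_smul]
        obtain ⟨e, he⟩ := swap u
        rw [wedge_cons, mul_assoc, he, mul_smul_comm, ← mul_assoc, ExteriorAlgebra.ι_sq_zero,
          zero_mul, smul_zero]
  rw [← hu.span] at hx
  obtain ⟨y, hy, z, hz, rfl⟩ := Submodule.mem_sup.1 hx
  have hz0 : M.mkQ z = 0 := by simpa using hz
  rw [map_add, hz0, add_zero]
  induction hy using Submodule.span_induction with
  | mem y hy => exact key u y hy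
  | zero => simp
  | add a b ha hb iha ihb =>
    have h1 := iha (hu.span ▸ Submodule.add_mem_sup ha hz)
    have h2 := ihb (hu.span ▸ Submodule.add_mem_sup hb hz)
    rw [map_add, map_add, mul_add, h1, h2, add_zero]
  | smul r a ha iha =>
    rw [map_smul, map_smul, mul_smul_comm, iha (hu.span ▸ Submodule.add_mem_sup ha hz), smul_zero]

/-- Proportionality of wedge products is preserved when a frame of `N / M` is prepended. -/
theorem wedge_append_smul {M N : Submodule k V} {u : List V} (hu : IsFrame M N u)
    {c c' : List V} {r : kˣ} (h : wedge N c' = r • wedge N c) :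
    wedge M (u ++ c') = r • wedge M (u ++ c) := by
  obtain ⟨F, hF⟩ := exists_mul_wedge hu.le
  rw [wedge_append, wedge_append, hF _ (fun x hx => wedge_mul_eq_zero hu hx),
    hF _ (fun x hx => wedge_mul_eq_zero hu hx), h, Units.smul_def, Units.smul_def,
    LinearMap.map_smul, mul_smul_comm]

theorem wedge_smul_append {M : Submodule k V} {u u' : List V} {r : kˣ}
    (h : wedge M u' = r • wedge M u) (c : List V) :
    wedge M (u' ++ c) = r • wedge M (u ++ c) := by
  rw [wedge_append, wedge_append, h, smul_mul_assoc]

/-- Concatenating a frame of `N / M` with a frame of `B / N` gives a frame of `B / M`. -/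
theorem IsFrame.append {M N B : Submodule k V} {u c : List V} (hu : IsFrame M N u)
    (hc : IsFrame N B c) : IsFrame M B (u ++ c) := by
  refine ⟨?_, ?_⟩
  · have h2 : LinearIndependent k ((Submodule.factor hu.le) ∘
        fun i : Fin c.length => M.mkQ (c.get i)) := hc.indep
    have h3 := LinearIndependent.sum_type hu.indep h2.of_comp (by
      refine Disjoint.symm ((Submodule.range_ker_disjoint h2).mono_right ?_)
      rw [Submodule.span_le]
      rintro _ ⟨i, rfl⟩
      have : u.get i ∈ N := hu.mem (List.get_mem u i)
      simpa using this)
    refine (linearIndependent_equiv' (finSumFinEquiv.trans (finCongr List.length_append.symm))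
      ?_).1 h3
    funext i
    rcases i with i | i <;> simp
  · have : {x | x ∈ u ++ c} = {x | x ∈ u} ∪ {x | x ∈ c} := by ext x; simp
    rw [this, Submodule.span_union, sup_assoc, sup_comm, sup_assoc, sup_comm M, hu.span, hc.span]

theorem IsFrame.nil (N : Submodule k V) : IsFrame N N [] :=
  ⟨@linearIndependent_empty_type _ _ _ _ _ _ _ Fin.isEmpty', by simp⟩

theorem isFrame_ofFn {N B : Submodule k V} {n : ℕ} (y : Fin n → V)
    (h1 : LinearIndependent k (fun i => N.mkQ (y i)))
    (h2 : Submodule.span k (Set.range y) ⊔ N = B) : IsFrame N B (List.ofFn y) := by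
  refine ⟨?_, ?_⟩
  · have h3 : (fun i : Fin (List.ofFn y).length => N.mkQ ((List.ofFn y).get i)) =
        (fun i => N.mkQ (y i)) ∘ finCongr (List.length_ofFn (f := y)) := by
      funext i
      rw [Function.comp_apply, List.get_ofFn]
      rfl
    rw [h3]
    exact h1.comp _ (Equiv.injective _)
  · have h2' : {x | x ∈ List.ofFn y} = Set.range y := by ext x; simp [List.mem_ofFn]
    rw [h2', h2]

/-- A frame of `B / N` exists as soon as `B ≤ N + F` with `F` finite dimensional. -/
theorem exists_isFrame {N B F : Submodule k V} (hNB : N ≤ B) (hF : F.FG) (hB : B ≤ N ⊔ F) :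
    ∃ l, IsFrame N B l := by
  have : FiniteDimensional k ↥(B.map N.mkQ) := by
    have h1 : B.map N.mkQ ≤ F.map N.mkQ := by
      calc B.map N.mkQ ≤ (N ⊔ F).map N.mkQ := Submodule.map_mono hB
        _ = F.map N.mkQ := by rw [Submodule.map_sup]; simp
    have h2 : FiniteDimensional k ↥(F.map N.mkQ) := Module.Finite.iff_fg.2 (hF.map _)
    exact Submodule.finiteDimensional_of_le h1
  obtain ⟨n, ⟨e⟩⟩ : ∃ n : ℕ, Nonempty (Module.Basis (Fin n) k ↥(B.map N.mkQ)) :=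
    ⟨_, ⟨Module.finBasis k ↥(B.map N.mkQ)⟩⟩
  choose y hyB hy using fun i => (Submodule.mem_map.1 (e i).2)
  have h1 : LinearIndependent k (fun i => ((e i : ↥(B.map N.mkQ)) : V ⧸ N)) :=
    e.linearIndependent.map' _ (Submodule.ker_subtype _)
  refine ⟨List.ofFn y, isFrame_ofFn y (by simpa only [hy] using h1) ?_⟩
  have h3 : (Submodule.span k (Set.range y)).map N.mkQ = B.map N.mkQ := by
    rw [Submodule.map_span, ← Set.range_comp]
    have h4 : (N.mkQ ∘ y) = (B.map N.mkQ).subtype ∘ e := by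
      funext i; exact hy i
    rw [h4, Set.range_comp, ← Submodule.map_span, e.span_eq, Submodule.map_top,
      Submodule.range_subtype]
  have h5 := congrArg (Submodule.comap N.mkQ) h3
  rw [Submodule.comap_map_mkQ, Submodule.comap_map_mkQ, sup_eq_right.2 hNB] at h5
  rw [sup_comm, h5]


theorem commensurable_iff {A B : Submodule k V} :
    Commensurable A B ↔ ∃ F : Submodule k V, F.FG ∧ A ≤ B ⊔ F ∧ B ≤ A ⊔ F := by
  constructor
  · intro h
    unfold Commensurable at h
    obtain ⟨F, hF⟩ := ((A ⊓ B).submoduleOf (A ⊔ B)).exists_isCompl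
    have hfin : FiniteDimensional k F :=
      (Submodule.quotientEquivOfIsCompl _ _ hF).finiteDimensional
    have key : A ⊔ B ≤ (A ⊓ B) ⊔ F.map (A ⊔ B).subtype := by
      have h1 := congrArg (Submodule.map (A ⊔ B).subtype) hF.sup_eq_top
      rw [Submodule.map_sup, Submodule.map_top, Submodule.range_subtype] at h1
      refine h1.ge.trans (sup_le_sup_right ?_ _)
      exact Submodule.map_comap_le _ _
    refine ⟨F.map (A ⊔ B).subtype, (Module.Finite.iff_fg.1 hfin).map _, ?_, ?_⟩
    · exact (le_sup_left.trans key).trans (sup_le_sup_right inf_le_right _)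
    · exact (le_sup_right.trans key).trans (sup_le_sup_right inf_le_left _)
  · rintro ⟨F, hF, hAB, hBA⟩
    unfold Commensurable
    have hfF : FiniteDimensional k F := Module.Finite.iff_fg.2 hF
    -- the kernel of `A × B → V/B × V/A`
    let g : ↥(A ⊔ B) →ₗ[k] (V ⧸ B) × (V ⧸ A) :=
      (B.mkQ.comp (A ⊔ B).subtype).prod (A.mkQ.comp (A ⊔ B).subtype)
    have hker : LinearMap.ker g = (A ⊓ B).submoduleOf (A ⊔ B) := by
      ext x
      simp [g, Submodule.submoduleOf, LinearMap.mem_ker, and_comm]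
    rw [← hker]
    have hr : LinearMap.range g ≤ (F.map B.mkQ).prod (F.map A.mkQ) := by
      rintro _ ⟨x, rfl⟩
      have h1 : A ⊔ B ≤ B ⊔ F := sup_le hAB le_sup_left
      have h2 : A ⊔ B ≤ A ⊔ F := sup_le le_sup_left hBA
      refine ⟨?_, ?_⟩
      · obtain ⟨b, hb, f, hf, hx⟩ := Submodule.mem_sup.1 (h1 x.2)
        exact ⟨f, hf, by
          have : B.mkQ b = 0 := by simpa using hb
          change B.mkQ f = B.mkQ x
          rw [← hx, map_add, this, zero_add]⟩
      · obtain ⟨b, hb, f, hf, hx⟩ := Submodule.mem_sup.1 (h2 x.2)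
        exact ⟨f, hf, by
          have : A.mkQ b = 0 := by simpa using hb
          change A.mkQ f = A.mkQ x
          rw [← hx, map_add, this, zero_add]⟩
    have hfin : FiniteDimensional k ↥((F.map B.mkQ).prod (F.map A.mkQ)) :=
      Module.Finite.iff_fg.2 ((hF.map _).prod (hF.map _))
    have := Submodule.finiteDimensional_of_le hr
    exact g.quotKerEquivRange.symm.finiteDimensional

theorem Commensurable.refl (A : Submodule k V) : Commensurable A A :=
  commensurable_iff.2 ⟨⊥, Submodule.fg_bot, by simp, by simp⟩

theorem Commensurable.symm {A B : Submodule k V} (h : Commensurable A B) : Commensurable B A := by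
  obtain ⟨F, hF, h1, h2⟩ := commensurable_iff.1 h
  exact commensurable_iff.2 ⟨F, hF, h2, h1⟩

theorem Commensurable.trans {A B C : Submodule k V} (h : Commensurable A B)
    (h' : Commensurable B C) : Commensurable A C := by
  obtain ⟨F, hF, h1, h2⟩ := commensurable_iff.1 h
  obtain ⟨F', hF', h1', h2'⟩ := commensurable_iff.1 h'
  refine commensurable_iff.2 ⟨F ⊔ F', hF.sup hF', ?_, ?_⟩
  · calc A ≤ B ⊔ F := h1
      _ ≤ (C ⊔ F') ⊔ F := sup_le_sup_right h1' _
      _ = C ⊔ (F ⊔ F') := by rw [sup_assoc, sup_comm F']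
  · calc C ≤ B ⊔ F' := h2'
      _ ≤ (A ⊔ F) ⊔ F' := sup_le_sup_right h2 _
      _ = A ⊔ (F ⊔ F') := by rw [sup_assoc]

theorem Commensurable.map {V' : Type*} [AddCommGroup V'] [Module k V'] {A B : Submodule k V}
    (h : Commensurable A B) (f : V →ₗ[k] V') : Commensurable (A.map f) (B.map f) := by
  obtain ⟨F, hF, h1, h2⟩ := commensurable_iff.1 h
  refine commensurable_iff.2 ⟨F.map f, hF.map f, ?_, ?_⟩
  · rw [← Submodule.map_sup]; exact Submodule.map_mono h1
  · rw [← Submodule.map_sup]; exact Submodule.map_mono h2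

theorem Commensurable.inf {A B C : Submodule k V} (h : Commensurable A B) (h' : Commensurable A C) :
    Commensurable A (B ⊓ C) := by
  have h1 : FiniteDimensional k ↥(A.map B.mkQ) := by
    obtain ⟨F, hF, h1, h2⟩ := commensurable_iff.1 h
    have h1 : A.map B.mkQ ≤ F.map B.mkQ := by
      calc A.map B.mkQ ≤ (B ⊔ F).map B.mkQ := Submodule.map_mono h1
        _ = F.map B.mkQ := by rw [Submodule.map_sup]; simp
    have h2 : FiniteDimensional k ↥(F.map B.mkQ) := Module.Finite.iff_fg.2 (hF.map _)
    exact Submodule.finiteDimensional_of_le h1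
  have h2 : FiniteDimensional k ↥(A.map C.mkQ) := by
    obtain ⟨F, hF, h1, h2⟩ := commensurable_iff.1 h'
    have h1 : A.map C.mkQ ≤ F.map C.mkQ := by
      calc A.map C.mkQ ≤ (C ⊔ F).map C.mkQ := Submodule.map_mono h1
        _ = F.map C.mkQ := by rw [Submodule.map_sup]; simp
    have h2 : FiniteDimensional k ↥(F.map C.mkQ) := Module.Finite.iff_fg.2 (hF.map _)
    exact Submodule.finiteDimensional_of_le h1
  let g : ↥A →ₗ[k] (V ⧸ B) × (V ⧸ C) :=
    (B.mkQ.comp A.subtype).prod (C.mkQ.comp A.subtype)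
  have hr : LinearMap.range g ≤ (A.map B.mkQ).prod (A.map C.mkQ) := by
    rintro _ ⟨x, rfl⟩
    exact ⟨⟨x, x.2, rfl⟩, ⟨x, x.2, rfl⟩⟩
  have hfin : FiniteDimensional k ↥((A.map B.mkQ).prod (A.map C.mkQ)) :=
    Module.Finite.iff_fg.2 ((Module.Finite.iff_fg.1 h1).prod (Module.Finite.iff_fg.1 h2))
  have hfin2 := Submodule.finiteDimensional_of_le hr
  obtain ⟨G, hG⟩ := (LinearMap.ker g).exists_isCompl
  have hGfin : FiniteDimensional k G :=
    ((Submodule.quotientEquivOfIsCompl _ _ hG).symm.trans g.quotKerEquivRange).symm.finiteDimensional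
  have hA : A ≤ (B ⊓ C) ⊔ G.map A.subtype := by
    have h3 := congrArg (Submodule.map A.subtype) hG.sup_eq_top
    rw [Submodule.map_sup, Submodule.map_top, Submodule.range_subtype] at h3
    refine h3.ge.trans (sup_le_sup_right ?_ _)
    rintro _ ⟨x, hx, rfl⟩
    have hx' : g x = 0 := hx
    simpa [g] using hx'
  obtain ⟨F, hF, h3, h4⟩ := commensurable_iff.1 h
  refine commensurable_iff.2 ⟨G.map A.subtype ⊔ F,
    ((Module.Finite.iff_fg.1 hGfin).map _).sup hF, ?_, ?_⟩
  · exact hA.trans (sup_le_sup_left le_sup_left _)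
  · exact (inf_le_left.trans h4).trans (sup_le_sup_left le_sup_right _)

theorem Commensurable.exists_isFrame {N B : Submodule k V} (h : Commensurable N B) (hNB : N ≤ B) :
    ∃ l, IsFrame N B l := by
  obtain ⟨F, hF, h1, h2⟩ := commensurable_iff.1 h
  exact TameSymbol.exists_isFrame hNB hF h2

theorem IsFrame.commensurable {N B : Submodule k V} {l : List V} (h : IsFrame N B l) :
    Commensurable N B := by
  refine commensurable_iff.2 ⟨Submodule.span k {x | x ∈ l},
    Submodule.fg_span (List.finite_toSet l), h.le.trans le_sup_left, ?_⟩
  rw [sup_comm, h.span]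


/-- An isomorphism `φ` from the determinant line of `C` to the determinant line of `B`, i.e. a
nonzero element of the relative determinant line `(B | C) = Hom (det C, det B)` of two commensurable
subspaces. For `N ≤ B ∩ C` of finite codimension in both this is an isomorphism
`φ_N : det (C / N) → det (B / N)` of one-dimensional spaces, and it is recorded by the scalars
`toFun N c b` such that `φ_N (c₁ ∧ ... ∧ c_m) = toFun N c b • (b₁ ∧ ... ∧ b_n)` for all frames
`c` of `C / N` and `b` of `B / N`. The isomorphisms for different `N` are required to correspond to
each other under the canonical identifications `det (N / M) ⊗ det (C / N) = det (C / M)`,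
`det (N / M) ⊗ det (B / N) = det (B / M)`. -/
@[ext]
structure DetIso (C B : Submodule k V) where
  /-- the scalar by which `φ_N` relates two frames -/
  toFun : Submodule k V → List V → List V → kˣ
  smul_left : ∀ {N : Submodule k V} {c c' b : List V} {r : kˣ}, IsFrame N C c → IsFrame N C c' →
    IsFrame N B b → wedge N c' = r • wedge N c → toFun N c' b = r * toFun N c b
  smul_right : ∀ {N : Submodule k V} {c b b' : List V} {r : kˣ}, IsFrame N C c → IsFrame N B b →
    IsFrame N B b' → wedge N b' = r • wedge N b → toFun N c b = toFun N c b' * r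
  append : ∀ {M N : Submodule k V} {u c b : List V}, IsFrame M N u → IsFrame N C c →
    IsFrame N B b → toFun M (u ++ c) (u ++ b) = toFun N c b
  /-- normalization of the irrelevant values -/
  eq_one : ∀ {N : Submodule k V} {c b : List V}, ¬ (IsFrame N C c ∧ IsFrame N B b) →
    toFun N c b = 1

namespace DetIso

variable {A B C D : Submodule k V}

/-- common refinement of two pairs of frames -/
theorem exists_refine {N N' : Submodule k V} {b b' : List V} (hb : IsFrame N B b)
    (hb' : IsFrame N' B b') : ∃ (M : Submodule k V) (u u' : List V), IsFrame M N u ∧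
      IsFrame M N' u' := by
  have h : Commensurable N N' := hb.commensurable.trans hb'.commensurable.symm
  have h1 : Commensurable N (N ⊓ N') := (Commensurable.refl N).inf h
  obtain ⟨u, hu⟩ := h1.symm.exists_isFrame inf_le_left
  obtain ⟨u', hu'⟩ := (h1.symm.trans h).exists_isFrame inf_le_right
  exact ⟨_, u, u', hu, hu'⟩

theorem append_append {M N : Submodule k V} (a : DetIso C B) {u c b : List V}
    (hu : IsFrame M N u) (hc : IsFrame N C c) (hb : IsFrame N B b) {c₀ b₀ : List V} {r s : kˣ}
    (hc₀ : IsFrame M C c₀) (hb₀ : IsFrame M B b₀)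
    (hr : wedge M (u ++ c) = r • wedge M c₀) (hs : wedge M (u ++ b) = s • wedge M b₀) :
    a.toFun N c b * s = r * a.toFun M c₀ b₀ := by
  rw [← a.append hu hc hb, a.smul_left hc₀ (hu.append hc) (hu.append hb) hr, mul_assoc,
    ← a.smul_right hc₀ hb₀ (hu.append hb) hs]

/-- An isomorphism of determinant lines is determined by a single value. -/
theorem ext_of_frame {a a' : DetIso C B} {N₀ : Submodule k V} {c₀ b₀ : List V}
    (hc₀ : IsFrame N₀ C c₀) (hb₀ : IsFrame N₀ B b₀) (h : a.toFun N₀ c₀ b₀ = a'.toFun N₀ c₀ b₀) :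
    a = a' := by
  ext1
  funext N c b
  by_cases hcb : IsFrame N C c ∧ IsFrame N B b
  · obtain ⟨hc, hb⟩ := hcb
    obtain ⟨M, u, u₀, hu, hu₀⟩ := exists_refine hc hc₀
    obtain ⟨r, hr⟩ := (hu₀.append hc₀).exists_smul (hu.append hc)
    obtain ⟨s, hs⟩ := (hu₀.append hb₀).exists_smul (hu.append hb)
    have h1 := a.append_append hu hc hb (hu₀.append hc₀) (hu₀.append hb₀) hr hs
    have h2 := a'.append_append hu hc hb (hu₀.append hc₀) (hu₀.append hb₀) hr hs
    rw [a.append hu₀ hc₀ hb₀] at h1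
    rw [a'.append hu₀ hc₀ hb₀, ← h, ← h1] at h2
    exact (mul_right_cancel h2).symm
  · rw [a.eq_one hcb, a'.eq_one hcb]

theorem exists_value {N₀ : Submodule k V} {c₀ b₀ : List V} (hc₀ : IsFrame N₀ C c₀)
    (hb₀ : IsFrame N₀ B b₀) (r₀ : kˣ) {N : Submodule k V} {c b : List V} (hc : IsFrame N C c)
    (hb : IsFrame N B b) : ∃ t : kˣ, ∀ (M : Submodule k V) (u u₀ : List V) (r s : kˣ),
      IsFrame M N u → IsFrame M N₀ u₀ → wedge M (u ++ c) = r • wedge M (u₀ ++ c₀) →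
      wedge M (u ++ b) = s • wedge M (u₀ ++ b₀) → t * s = r * r₀ := by
  obtain ⟨M, u, u₀, hu, hu₀⟩ := exists_refine hc hc₀
  obtain ⟨r, hr⟩ := (hu₀.append hc₀).exists_smul (hu.append hc)
  obtain ⟨s, hs⟩ := (hu₀.append hb₀).exists_smul (hu.append hb)
  refine ⟨r * r₀ * s⁻¹, fun M' u' u₀' r' s' hu' hu₀' hr' hs' => ?_⟩
  obtain ⟨L, v, v', hv, hv'⟩ := exists_refine hu hu'
  obtain ⟨p, hp⟩ := (hv.append hu).exists_smul (hv'.append hu')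
  obtain ⟨q, hq⟩ := (hv.append hu₀).exists_smul (hv'.append hu₀')
  have key : ∀ (x x₀ : List V) (z z' : kˣ), IsFrame N₀ B x₀ ∨ IsFrame N₀ C x₀ →
      wedge M (u ++ x) = z • wedge M (u₀ ++ x₀) →
      wedge M' (u' ++ x) = z' • wedge M' (u₀' ++ x₀) → p * z = z' * q := by
    intro x x₀ z z' hx₀ h1 h2
    have e1 := wedge_append_smul hv h1
    have e2 := wedge_append_smul hv' h2
    have e3 := wedge_smul_append hp x
    have e4 := wedge_smul_append hq x₀
    rw [← List.append_assoc, ← List.append_assoc] at e1 e2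
    rw [e3, e1, e4, smul_smul, smul_smul] at e2
    rcases hx₀ with hx₀ | hx₀
    · exact smul_wedge_inj ((hv.append hu₀).append hx₀) e2
    · exact smul_wedge_inj ((hv.append hu₀).append hx₀) e2
  have k1 := key c c₀ r r' (Or.inr hc₀) hr hr'
  have k2 := key b b₀ s s' (Or.inl hb₀) hs hs'
  have h1 : r' = p * r * q⁻¹ := by rw [k1]; simp
  have h2 : s' = p * s * q⁻¹ := by rw [k2]; simp
  rw [h1, h2]
  calc r * r₀ * s⁻¹ * (p * s * q⁻¹) = (p * r * q⁻¹ * r₀) * (s⁻¹ * s) := by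
        simp only [mul_assoc, mul_comm, mul_left_comm]
    _ = p * r * q⁻¹ * r₀ := by simp

open Classical in
/-- The isomorphism of determinant lines with a prescribed value on one pair of frames. -/
noncomputable def ofValue {N₀ : Submodule k V} {c₀ b₀ : List V} (hc₀ : IsFrame N₀ C c₀)
    (hb₀ : IsFrame N₀ B b₀) (r₀ : kˣ) : DetIso C B where
  toFun N c b := if h : IsFrame N C c ∧ IsFrame N B b then
    (exists_value hc₀ hb₀ r₀ h.1 h.2).choose else 1
  smul_left := by
    intro N c c' b r hc hc' hb h
    rw [dif_pos ⟨hc', hb⟩, dif_pos ⟨hc, hb⟩]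
    obtain ⟨M, u, u₀, hu, hu₀⟩ := exists_refine hc hc₀
    obtain ⟨x, hx⟩ := (hu₀.append hc₀).exists_smul (hu.append hc)
    obtain ⟨s, hs⟩ := (hu₀.append hb₀).exists_smul (hu.append hb)
    have h1 := (exists_value hc₀ hb₀ r₀ hc hb).choose_spec M u u₀ x s hu hu₀ hx hs
    have h2 := (exists_value hc₀ hb₀ r₀ hc' hb).choose_spec M u u₀ (r * x) s hu hu₀
      (by rw [wedge_append_smul hu h, hx, smul_smul]) hs
    rw [mul_assoc, ← h1, ← mul_assoc] at h2
    exact mul_right_cancel h2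
  smul_right := by
    intro N c b b' r hc hb hb' h
    rw [dif_pos ⟨hc, hb⟩, dif_pos ⟨hc, hb'⟩]
    obtain ⟨M, u, u₀, hu, hu₀⟩ := exists_refine hc hc₀
    obtain ⟨x, hx⟩ := (hu₀.append hc₀).exists_smul (hu.append hc)
    obtain ⟨s, hs⟩ := (hu₀.append hb₀).exists_smul (hu.append hb)
    have h1 := (exists_value hc₀ hb₀ r₀ hc hb).choose_spec M u u₀ x s hu hu₀ hx hs
    have h2 := (exists_value hc₀ hb₀ r₀ hc hb').choose_spec M u u₀ x (r * s) hu hu₀ hx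
      (by rw [wedge_append_smul hu h, hs, smul_smul])
    rw [← h1, ← mul_assoc] at h2
    exact (mul_right_cancel h2).symm
  append := by
    intro L N z c b hz hc hb
    rw [dif_pos ⟨hz.append hc, hz.append hb⟩, dif_pos ⟨hc, hb⟩]
    obtain ⟨M, u, u₀, hu, hu₀⟩ := exists_refine (hz.append hc) hc₀
    obtain ⟨x, hx⟩ := (hu₀.append hc₀).exists_smul (hu.append (hz.append hc))
    obtain ⟨s, hs⟩ := (hu₀.append hb₀).exists_smul (hu.append (hz.append hb))
    have h1 := (exists_value hc₀ hb₀ r₀ (hz.append hc) (hz.append hb)).choose_spec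
      M u u₀ x s hu hu₀ hx hs
    rw [← List.append_assoc] at hx hs
    have h2 := (exists_value hc₀ hb₀ r₀ hc hb).choose_spec
      M (u ++ z) u₀ x s (hu.append hz) hu₀ hx hs
    rw [← h2] at h1
    exact mul_right_cancel h1
  eq_one := fun h => dif_neg h

theorem ofValue_apply {N₀ : Submodule k V} {c₀ b₀ : List V} (hc₀ : IsFrame N₀ C c₀)
    (hb₀ : IsFrame N₀ B b₀) (r₀ : kˣ) : (ofValue hc₀ hb₀ r₀).toFun N₀ c₀ b₀ = r₀ := by
  have h : (ofValue hc₀ hb₀ r₀).toFun N₀ c₀ b₀ = (exists_value hc₀ hb₀ r₀ hc₀ hb₀).choose :=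
    dif_pos ⟨hc₀, hb₀⟩
  rw [h]
  simpa using (exists_value hc₀ hb₀ r₀ hc₀ hb₀).choose_spec N₀ [] [] 1 1 (IsFrame.nil _)
    (IsFrame.nil _) (by simp) (by simp)

theorem exists_common (hBC : Commensurable B C) (hBD : Commensurable B D) :
    ∃ (N : Submodule k V) (b c d : List V), IsFrame N B b ∧ IsFrame N C c ∧ IsFrame N D d := by
  have h : Commensurable B (B ⊓ (C ⊓ D)) := (Commensurable.refl B).inf (hBC.inf hBD)
  obtain ⟨b, hb⟩ := h.symm.exists_isFrame inf_le_left
  obtain ⟨c, hc⟩ := (h.symm.trans hBC).exists_isFrame (inf_le_right.trans inf_le_left)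
  obtain ⟨d, hd⟩ := (h.symm.trans hBD).exists_isFrame (inf_le_right.trans inf_le_right)
  exact ⟨_, b, c, d, hb, hc, hd⟩

theorem exists_comp (hBC : Commensurable B C) (hBD : Commensurable B D) (a : DetIso C B)
    (a' : DetIso D C) : ∃ a'' : DetIso D B, ∀ (N : Submodule k V) (b c d : List V),
      IsFrame N B b → IsFrame N C c → IsFrame N D d →
      a''.toFun N d b = a.toFun N c b * a'.toFun N d c := by
  obtain ⟨N₀, b₀, c₀, d₀, hb₀, hc₀, hd₀⟩ := exists_common hBC hBD
  refine ⟨ofValue hd₀ hb₀ (a.toFun N₀ c₀ b₀ * a'.toFun N₀ d₀ c₀), fun N b c d hb hc hd => ?_⟩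
  obtain ⟨M, u, u₀, hu, hu₀⟩ := exists_refine hc hc₀
  obtain ⟨x, hx⟩ := (hu₀.append hb₀).exists_smul (hu.append hb)
  obtain ⟨y, hy⟩ := (hu₀.append hc₀).exists_smul (hu.append hc)
  obtain ⟨z, hz⟩ := (hu₀.append hd₀).exists_smul (hu.append hd)
  have h1 := a.append_append hu hc hb (hu₀.append hc₀) (hu₀.append hb₀) hy hx
  have h2 := a'.append_append hu hd hc (hu₀.append hd₀) (hu₀.append hc₀) hz hy
  have h3 := (ofValue hd₀ hb₀ (a.toFun N₀ c₀ b₀ * a'.toFun N₀ d₀ c₀)).append_append hu hd hb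
    (hu₀.append hd₀) (hu₀.append hb₀) hz hx
  rw [a.append hu₀ hc₀ hb₀] at h1
  rw [a'.append hu₀ hd₀ hc₀] at h2
  rw [append _ hu₀ hd₀ hb₀, ofValue_apply] at h3
  apply mul_right_cancel (b := x)
  rw [h3]
  calc z * (a.toFun N₀ c₀ b₀ * a'.toFun N₀ d₀ c₀)
      = a.toFun N₀ c₀ b₀ * (z * a'.toFun N₀ d₀ c₀) := mul_left_comm _ _ _
    _ = a.toFun N₀ c₀ b₀ * (a'.toFun N d c * y) := by rw [h2]
    _ = (y * a.toFun N₀ c₀ b₀) * a'.toFun N d c := by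
        rw [mul_comm _ y, mul_left_comm, mul_assoc]
    _ = _ := by rw [← h1]; exact mul_right_comm _ _ _

/-- The composition `det D → det C → det B`, i.e. the canonical isomorphism
`(B | C) ⊗ (C | D) = (B | D)`. -/
noncomputable def comp (hBC : Commensurable B C) (hBD : Commensurable B D) (a : DetIso C B)
    (a' : DetIso D C) : DetIso D B :=
  (exists_comp hBC hBD a a').choose

theorem comp_apply (hBC : Commensurable B C) (hBD : Commensurable B D) (a : DetIso C B)
    (a' : DetIso D C) {N : Submodule k V} {b c d : List V} (hb : IsFrame N B b)
    (hc : IsFrame N C c) (hd : IsFrame N D d) :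
    (comp hBC hBD a a').toFun N d b = a.toFun N c b * a'.toFun N d c :=
  (exists_comp hBC hBD a a').choose_spec N b c d hb hc hd

/-- Multiplication by the scalar `r` on the determinant line of `B`. -/
noncomputable def scalar (B : Submodule k V) (r : kˣ) : DetIso B B :=
  ofValue (IsFrame.nil B) (IsFrame.nil B) r

theorem scalar_apply (r : kˣ) {N : Submodule k V} {b : List V} (hb : IsFrame N B b) :
    (scalar B r).toFun N b b = r := by
  have h := (scalar B r).append hb (IsFrame.nil B) (IsFrame.nil B)
  rw [List.append_nil] at h
  rw [h, scalar, ofValue_apply]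

/-- The inverse isomorphism. -/
noncomputable def symm (a : DetIso C B) : DetIso B C where
  toFun N b c := (a.toFun N c b)⁻¹
  smul_left := by
    intro N c c' b r hc hc' hb h
    rw [a.smul_right hb hc hc' h]
    simp
  smul_right := by
    intro N c b b' r hc hb hb' h
    rw [a.smul_left hb hb' hc h]
    simp [mul_comm]
  append := by
    intro M N u c b hu hc hb
    rw [a.append hu hb hc]
  eq_one := by
    intro N c b h
    rw [a.eq_one (fun h' => h h'.symm), inv_one]

/-- Transport along an equality of subspaces. -/
def cast {C' B' : Submodule k V} (hC : C = C') (hB : B = B') (a : DetIso C B) : DetIso C' B' where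
  toFun := a.toFun
  smul_left := by subst hC hB; exact a.smul_left
  smul_right := by subst hC hB; exact a.smul_right
  append := by subst hC hB; exact a.append
  eq_one := by subst hC hB; exact a.eq_one

end DetIso

theorem IsFrame.of_map {N B : Submodule k V} {l : List V} (f : V ≃ₗ[k] V) (h : IsFrame N B l) :
    IsFrame (N.map (f : V →ₗ[k] V)) (B.map (f : V →ₗ[k] V)) (l.map f) := by
  refine ⟨?_, ?_⟩
  · let g : (V ⧸ N) ≃ₗ[k] (V ⧸ N.map (f : V →ₗ[k] V)) := Submodule.Quotient.equiv N _ f rfl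
    have h1 := h.indep.map' (g : (V ⧸ N) →ₗ[k] (V ⧸ N.map (f : V →ₗ[k] V))) g.ker
    refine (linearIndependent_equiv' (finCongr (List.length_map (f := f) (as := l)).symm)
      ?_).1 h1
    funext i
    simp [g]
  · rw [← h.span, Submodule.map_sup, Submodule.map_span]
    congr 2
    ext x
    simp

theorem isFrame_comap_iff {N B : Submodule k V} {l : List V} (f : V ≃ₗ[k] V) :
    IsFrame (N.comap (f : V →ₗ[k] V)) B (l.map f.symm) ↔
      IsFrame N (B.map (f : V →ₗ[k] V)) l := by
  constructor
  · intro h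
    have h1 := h.of_map f
    rw [Submodule.map_comap_eq_of_surjective f.surjective, List.map_map] at h1
    have h2 : (f : V → V) ∘ f.symm = id := by funext x; simp
    rwa [h2, List.map_id] at h1
  · intro h
    have h1 := h.of_map f.symm
    have h2 : (B.map (f : V →ₗ[k] V)).map (f.symm : V →ₗ[k] V) = B := by
      rw [← Submodule.map_comp]; simp
    have h3 : N.map (f.symm : V →ₗ[k] V) = N.comap (f : V →ₗ[k] V) :=
      (Submodule.comap_equiv_eq_map_symm f N).symm
    rwa [h2, h3] at h1

theorem wedge_comap_smul {N : Submodule k V} {l l' : List V} (f : V ≃ₗ[k] V) {r : kˣ}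
    (h : wedge N l' = r • wedge N l) :
    wedge (N.comap (f : V →ₗ[k] V)) (l'.map f.symm) =
      r • wedge (N.comap (f : V →ₗ[k] V)) (l.map f.symm) := by
  have h3 : (N.comap (f : V →ₗ[k] V)).comap (f.symm : V →ₗ[k] V) = N := by
    rw [← Submodule.comap_comp]; simp
  have key : ∀ l : List V, wedge (N.comap (f : V →ₗ[k] V)) (l.map f.symm) =
      ExteriorAlgebra.map (N.mapQ (N.comap (f : V →ₗ[k] V)) (f.symm : V →ₗ[k] V) h3.ge)
        (wedge N l) := by
    intro l
    induction l with
    | nil => simp [wedge_nil]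
    | cons x l ih =>
      rw [List.map_cons, wedge_cons, wedge_cons, ih, map_mul, ExteriorAlgebra.map_apply_ι]
      simp
  rw [key, key, h, Units.smul_def, Units.smul_def, map_smul]

namespace DetIso

variable {A B C D : Submodule k V}

/-- The isomorphism `det (f C) → det (f B)` obtained from `det C → det B` by transport of
structure along an automorphism `f` of `V`. -/
def push (f : V ≃ₗ[k] V) (a : DetIso C B) :
    DetIso (C.map (f : V →ₗ[k] V)) (B.map (f : V →ₗ[k] V)) where
  toFun N c b := a.toFun (N.comap (f : V →ₗ[k] V)) (c.map f.symm) (b.map f.symm)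
  smul_left := by
    intro N c c' b r hc hc' hb h
    exact a.smul_left ((isFrame_comap_iff f).2 hc) ((isFrame_comap_iff f).2 hc')
      ((isFrame_comap_iff f).2 hb) (wedge_comap_smul f h)
  smul_right := by
    intro N c b b' r hc hb hb' h
    exact a.smul_right ((isFrame_comap_iff f).2 hc) ((isFrame_comap_iff f).2 hb)
      ((isFrame_comap_iff f).2 hb') (wedge_comap_smul f h)
  append := by
    intro M N u c b hu hc hb
    rw [List.map_append, List.map_append]
    have hu' : IsFrame (M.comap (f : V →ₗ[k] V)) (N.comap (f : V →ₗ[k] V)) (u.map f.symm) := by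
      rw [isFrame_comap_iff, Submodule.map_comap_eq_of_surjective f.surjective]
      exact hu
    exact a.append hu' ((isFrame_comap_iff f).2 hc) ((isFrame_comap_iff f).2 hb)
  eq_one := by
    intro N c b h
    exact a.eq_one (fun h' => h ⟨(isFrame_comap_iff f).1 h'.1, (isFrame_comap_iff f).1 h'.2⟩)

end DetIso
end Determinants

section Extension

variable {k : Type u} [Field k] {V : Type v} [AddCommGroup V] [Module k V]

theorem map_mul_eq (f g : V ≃ₗ[k] V) (A : Submodule k V) :
    A.map ((f * g : V ≃ₗ[k] V) : V →ₗ[k] V) =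
      (A.map (g : V →ₗ[k] V)).map (f : V →ₗ[k] V) := by
  rw [← Submodule.map_comp]; rfl

theorem map_one_eq (A : Submodule k V) : A.map ((1 : V ≃ₗ[k] V) : V →ₗ[k] V) = A :=
  Submodule.map_id A

theorem map_map_inv (f : V ≃ₗ[k] V) (A : Submodule k V) :
    (A.map (f : V →ₗ[k] V)).map ((f⁻¹ : V ≃ₗ[k] V) : V →ₗ[k] V) = A := by
  rw [← map_mul_eq, inv_mul_cancel, map_one_eq]

/-- The group `GL (V, A)` of all automorphisms `f` of `V` such that `f A` is commensurable
with `A`. -/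
def ResGL (A : Submodule k V) : Subgroup (V ≃ₗ[k] V) where
  carrier := {f | Commensurable (A.map (f : V →ₗ[k] V)) A}
  mul_mem' := by
    intro f g hf hg
    change Commensurable _ _
    rw [map_mul_eq]
    exact (Commensurable.map hg _).trans hf
  one_mem' := by
    change Commensurable _ _
    rw [map_one_eq]
    exact Commensurable.refl A
  inv_mem' := by
    intro f hf
    have h := Commensurable.map hf ((f⁻¹ : V ≃ₗ[k] V) : V →ₗ[k] V)
    rw [map_map_inv] at h
    exact h.symm

theorem mem_ResGL {A : Submodule k V} {f : V ≃ₗ[k] V} :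
    f ∈ ResGL A ↔ Commensurable (A.map (f : V →ₗ[k] V)) A := Iff.rfl

/-- The index of `f` over `A`: `dim (A / (A ∩ f A)) - dim (f A / (A ∩ f A))`. -/
noncomputable def index (A : Submodule k V) (f : ResGL A) : ℤ :=
  (Module.finrank k (↥A ⧸ (A ⊓ A.map (f.1 : V →ₗ[k] V)).submoduleOf A) : ℤ) -
    (Module.finrank k (↥(A.map (f.1 : V →ₗ[k] V)) ⧸
      (A ⊓ A.map (f.1 : V →ₗ[k] V)).submoduleOf (A.map (f.1 : V →ₗ[k] V))) : ℤ)

/-- An element of the determinantal central extension of `GL (V, A)`: a pair consisting of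
`f ∈ GL (V, A)` and a nonzero element of the line `(A | f A) = Hom (det (f A), det A)`. -/
structure DetExt (A : Submodule k V) where
  toGL : ResGL A
  det : DetIso (A.map (toGL.1 : V →ₗ[k] V)) A

namespace DetExt

variable {A : Submodule k V}

theorem ext_of_frame {x y : DetExt A} (h : x.toGL = y.toGL) {N : Submodule k V} {c b : List V}
    (hc : IsFrame N (A.map (x.toGL.1 : V →ₗ[k] V)) c) (hb : IsFrame N A b)
    (hv : x.det.toFun N c b = y.det.toFun N c b) : x = y := by
  obtain ⟨f, a⟩ := x
  obtain ⟨g, a'⟩ := y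
  obtain rfl : f = g := h
  exact congrArg (DetExt.mk f) (DetIso.ext_of_frame hc hb hv)

/-- `(f, a) (g, b) = (f g, a ∘ f b)`, where `f b : det (f g A) → det (f A)`. -/
noncomputable instance : Mul (DetExt A) where
  mul x y := ⟨x.toGL * y.toGL, DetIso.comp x.toGL.2.symm (x.toGL * y.toGL).2.symm x.det
    ((DetIso.push x.toGL.1 y.det).cast (map_mul_eq x.toGL.1 y.toGL.1 A).symm rfl)⟩

noncomputable instance : One (DetExt A) where
  one := ⟨1, (DetIso.scalar A 1).cast (map_one_eq A).symm rfl⟩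

noncomputable instance : Inv (DetExt A) where
  inv x := ⟨x.toGL⁻¹, (DetIso.push (x.toGL.1⁻¹ : V ≃ₗ[k] V) x.det.symm).cast rfl
    (map_map_inv x.toGL.1 A)⟩

theorem toGL_mul (x y : DetExt A) : (x * y).toGL = x.toGL * y.toGL := rfl

theorem toGL_one : (1 : DetExt A).toGL = 1 := rfl

theorem toGL_inv (x : DetExt A) : x⁻¹.toGL = x.toGL⁻¹ := rfl

theorem mul_apply (x y : DetExt A) {N : Submodule k V} {b c d : List V} (hb : IsFrame N A b)
    (hc : IsFrame N (A.map (x.toGL.1 : V →ₗ[k] V)) c)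
    (hd : IsFrame N (A.map ((x * y).toGL.1 : V →ₗ[k] V)) d) :
    (x * y).det.toFun N d b = x.det.toFun N c b *
      y.det.toFun (N.comap (x.toGL.1 : V →ₗ[k] V)) (d.map x.toGL.1.symm) (c.map x.toGL.1.symm) :=
  DetIso.comp_apply x.toGL.2.symm (x.toGL * y.toGL).2.symm x.det
    ((DetIso.push x.toGL.1 y.det).cast (map_mul_eq x.toGL.1 y.toGL.1 A).symm rfl) hb hc hd

theorem one_apply {N : Submodule k V} {b : List V} (hb : IsFrame N A b) :
    (1 : DetExt A).det.toFun N b b = 1 :=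
  DetIso.scalar_apply 1 hb

theorem exists_frames (f g : ResGL A) : ∃ (N : Submodule k V) (b c d : List V), IsFrame N A b ∧
    IsFrame N (A.map (f.1 : V →ₗ[k] V)) c ∧ IsFrame N (A.map (g.1 : V →ₗ[k] V)) d :=
  DetIso.exists_common f.2.symm g.2.symm

theorem exists_frames_three (f g h : ResGL A) : ∃ (N : Submodule k V) (b c d e : List V),
    IsFrame N A b ∧ IsFrame N (A.map (f.1 : V →ₗ[k] V)) c ∧
      IsFrame N (A.map (g.1 : V →ₗ[k] V)) d ∧ IsFrame N (A.map (h.1 : V →ₗ[k] V)) e := by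
  have h1 : Commensurable A (A ⊓ (A.map (f.1 : V →ₗ[k] V) ⊓
      (A.map (g.1 : V →ₗ[k] V) ⊓ A.map (h.1 : V →ₗ[k] V)))) :=
    (Commensurable.refl A).inf (f.2.symm.inf (g.2.symm.inf h.2.symm))
  obtain ⟨b, hb⟩ := h1.symm.exists_isFrame inf_le_left
  obtain ⟨c, hc⟩ := (h1.symm.trans f.2.symm).exists_isFrame (inf_le_right.trans inf_le_left)
  obtain ⟨d, hd⟩ := (h1.symm.trans g.2.symm).exists_isFrame
    (inf_le_right.trans (inf_le_right.trans inf_le_left))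
  obtain ⟨e, he⟩ := (h1.symm.trans h.2.symm).exists_isFrame
    (inf_le_right.trans (inf_le_right.trans inf_le_right))
  exact ⟨_, b, c, d, e, hb, hc, hd, he⟩

protected theorem mul_assoc (x y z : DetExt A) : x * y * z = x * (y * z) := by
  obtain ⟨N, b, c, d, e, hb, hc, hd, he⟩ :=
    exists_frames_three x.toGL (x * y).toGL (x * y * z).toGL
  refine ext_of_frame (mul_assoc x.toGL y.toGL z.toGL) he hb ?_
  have he' : IsFrame N (A.map ((x * (y * z)).toGL.1 : V →ₗ[k] V)) e := by
    have : (x * (y * z)).toGL = (x * y * z).toGL := (mul_assoc x.toGL y.toGL z.toGL).symm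
    rw [this]; exact he
  rw [mul_apply (x * y) z hb hd he, mul_apply x y hb hc hd, mul_apply x (y * z) hb hc he']
  have hc2 := (isFrame_comap_iff x.toGL.1).2 hc
  have hd2 := hd
  rw [toGL_mul, Subgroup.coe_mul, map_mul_eq, ← isFrame_comap_iff] at hd2
  have he2 := he'
  rw [toGL_mul, Subgroup.coe_mul, map_mul_eq, ← isFrame_comap_iff] at he2
  rw [mul_apply y z hc2 hd2 he2, mul_assoc, List.map_map, List.map_map]
  rfl

noncomputable instance : Group (DetExt A) :=
  Group.ofLeftAxioms DetExt.mul_assoc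
    (by
      intro x
      obtain ⟨N, b, c, -, hb, hc, -⟩ := exists_frames x.toGL x.toGL
      have h : (1 * x).toGL = x.toGL := one_mul x.toGL
      refine ext_of_frame h (h ▸ hc) hb ?_
      have hb' : IsFrame N (A.map ((1 : DetExt A).toGL.1 : V →ₗ[k] V)) b := by
        rw [toGL_one, Subgroup.coe_one, map_one_eq]; exact hb
      rw [mul_apply 1 x hb hb' (h ▸ hc), one_apply hb, one_mul]
      have h2 : ((1 : DetExt A).toGL.1.symm : V → V) = id := rfl
      rw [h2, List.map_id, List.map_id]
      rfl)
    (by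
      intro x
      obtain ⟨N, b, c, -, hb, hc, -⟩ := exists_frames x⁻¹.toGL x.toGL
      have h : (x⁻¹ * x).toGL = (1 : DetExt A).toGL := inv_mul_cancel x.toGL
      have hb' : IsFrame N (A.map ((x⁻¹ * x).toGL.1 : V →ₗ[k] V)) b := by
        rw [h, toGL_one, Subgroup.coe_one, map_one_eq]; exact hb
      refine ext_of_frame h hb' hb ?_
      rw [mul_apply x⁻¹ x hb hc hb', one_apply hb]
      exact inv_mul_cancel _)

/-- The projection onto `GL (V, A)`. -/
noncomputable def proj (A : Submodule k V) : DetExt A →* ResGL A where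
  toFun := toGL
  map_one' := rfl
  map_mul' _ _ := rfl

/-- The inclusion of `kˣ`: the scalar `r` is sent to `(1, r)`. -/
noncomputable def incl (A : Submodule k V) : kˣ →* DetExt A where
  toFun r := ⟨1, (DetIso.scalar A r).cast (map_one_eq A).symm rfl⟩
  map_one' := rfl
  map_mul' r s := by
    have hb := IsFrame.nil A
    have hb1 : IsFrame A (A.map ((1 : ResGL A).1 : V →ₗ[k] V)) [] := by
      rw [Subgroup.coe_one, map_one_eq]; exact hb
    refine ext_of_frame (mul_one 1).symm hb1 hb ?_
    refine Eq.trans ?_ (mul_apply (A := A) ⟨1, (DetIso.scalar A r).cast (map_one_eq A).symm rfl⟩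
      ⟨1, (DetIso.scalar A s).cast (map_one_eq A).symm rfl⟩ hb hb1 hb1).symm
    change (DetIso.scalar A (r * s)).toFun A [] [] =
      (DetIso.scalar A r).toFun A [] [] * (DetIso.scalar A s).toFun A [] []
    rw [DetIso.scalar_apply _ hb, DetIso.scalar_apply _ hb, DetIso.scalar_apply _ hb]

theorem incl_apply (r : kˣ) {N : Submodule k V} {b : List V} (hb : IsFrame N A b) :
    (incl A r).det.toFun N b b = r :=
  DetIso.scalar_apply r hb

theorem incl_mul_apply (r : kˣ) (x : DetExt A) {N : Submodule k V} {b c : List V}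
    (hb : IsFrame N A b) (hc : IsFrame N (A.map (x.toGL.1 : V →ₗ[k] V)) c) :
    (incl A r * x).det.toFun N c b = r * x.det.toFun N c b := by
  have hb' : IsFrame N (A.map ((incl A r).toGL.1 : V →ₗ[k] V)) b := by
    change IsFrame N (A.map ((1 : V ≃ₗ[k] V) : V →ₗ[k] V)) b
    rw [map_one_eq]; exact hb
  have hc' : IsFrame N (A.map ((incl A r * x).toGL.1 : V →ₗ[k] V)) c := by
    have : (incl A r * x).toGL = x.toGL := one_mul x.toGL
    rw [this]; exact hc
  rw [mul_apply _ _ hb hb' hc', incl_apply r hb]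
  have h2 : ((incl A r).toGL.1.symm : V → V) = id := rfl
  rw [h2, List.map_id, List.map_id]
  rfl

theorem incl_central (r : kˣ) (x : DetExt A) : incl A r * x = x * incl A r := by
  obtain ⟨N, b, c, -, hb, hc, -⟩ := exists_frames x.toGL x.toGL
  have h1 : (incl A r * x).toGL = x.toGL := one_mul x.toGL
  have h2 : (x * incl A r).toGL = x.toGL := mul_one x.toGL
  refine ext_of_frame (h1.trans h2.symm) (h1 ▸ hc) hb ?_
  rw [incl_mul_apply r x hb hc, mul_apply x _ hb hc (h2 ▸ hc),
    incl_apply r ((isFrame_comap_iff _).2 hc), mul_comm]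

/-- The determinantal central extension `1 → kˣ → DetExt A → GL (V, A) → 1`. -/
noncomputable def extension (A : Submodule k V) : GroupExtension kˣ (DetExt A) (ResGL A) where
  inl := incl A
  rightHom := proj A
  inl_injective := by
    intro r s h
    have h1 := incl_apply r (IsFrame.nil A)
    rw [h, incl_apply s (IsFrame.nil A)] at h1
    exact h1.symm
  range_inl_eq_ker_rightHom := by
    ext x
    constructor
    · rintro ⟨r, rfl⟩
      rfl
    · intro h
      have h : x.toGL = 1 := h
      have hb := IsFrame.nil A
      have hb1 : IsFrame A (A.map (x.toGL.1 : V →ₗ[k] V)) [] := by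
        rw [h, Subgroup.coe_one, map_one_eq]; exact hb
      refine ⟨x.det.toFun A [] [], (ext_of_frame h hb1 hb ?_).symm⟩
      rw [incl_apply _ hb]
  rightHom_surjective := by
    intro f
    obtain ⟨N, b, c, -, hb, hc, -⟩ := exists_frames f f
    exact ⟨⟨f, DetIso.ofValue hc hb 1⟩, rfl⟩

theorem extension_central (A : Submodule k V) :
    (extension A).inl.range ≤ Subgroup.center (DetExt A) := by
  rintro _ ⟨r, rfl⟩
  exact Subgroup.mem_center_iff.2 fun x => (incl_central r x).symm

end DetExt

end Extension

section Commutator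

open scoped commutatorElement

theorem commutator_lift_mem {N E Q : Type*} [Group N] [Group E] [Group Q]
    (S : GroupExtension N E Q) {s t : Q} (h : Commute s t) :
    ⁅Function.surjInv S.rightHom_surjective s, Function.surjInv S.rightHom_surjective t⁆ ∈
      S.inl.range := by
  rw [S.range_inl_eq_ker_rightHom, MonoidHom.mem_ker, map_commutatorElement,
    Function.surjInv_eq S.rightHom_surjective, Function.surjInv_eq S.rightHom_surjective]
  exact commutatorElement_eq_one_iff_commute.2 h

/-- For a group extension `1 → N → E → Q → 1` and commuting elements `s`, `t` of `Q`, the element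
of `N` whose image in `E` is the commutator `x y x⁻¹ y⁻¹` of lifts `x`, `y` of `s`, `t`. It does
not depend on the lifts when the extension is central, see `inl_extCommutator`. -/
noncomputable def extCommutator {N E Q : Type*} [Group N] [Group E] [Group Q]
    (S : GroupExtension N E Q) {s t : Q} (h : Commute s t) : N :=
  (commutator_lift_mem S h).choose

theorem inl_extCommutator {N E Q : Type*} [Group N] [Group E] [Group Q]
    (S : GroupExtension N E Q) (hS : S.inl.range ≤ Subgroup.center E) {s t : Q} (h : Commute s t)
    {x y : E} (hx : S.rightHom x = s) (hy : S.rightHom y = t) :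
    S.inl (extCommutator S h) = ⁅x, y⁆ := by
  have h1 : S.inl (extCommutator S h) = _ := (commutator_lift_mem S h).choose_spec
  rw [h1]
  have key : ∀ {a b : E}, S.rightHom a = S.rightHom b → ∃ z ∈ Subgroup.center E, a = z * b := by
    intro a b hab
    refine ⟨a * b⁻¹, hS ?_, by group⟩
    rw [S.range_inl_eq_ker_rightHom, MonoidHom.mem_ker, map_mul, map_inv, hab, mul_inv_cancel]
  obtain ⟨z, hz, hz'⟩ := key ((Function.surjInv_eq S.rightHom_surjective s).trans hx.symm)
  obtain ⟨w, hw, hw'⟩ := key ((Function.surjInv_eq S.rightHom_surjective t).trans hy.symm)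
  have hz1 := fun g => (Subgroup.mem_center_iff.1 hz g)
  have hw1 := fun g => (Subgroup.mem_center_iff.1 hw g)
  rw [hz', hw', commutatorElement_def, commutatorElement_def, mul_inv_rev, mul_inv_rev]
  calc z * x * (w * y) * (x⁻¹ * z⁻¹) * (y⁻¹ * w⁻¹)
      = z * (x * w) * y * x⁻¹ * (z⁻¹ * y⁻¹) * w⁻¹ := by group
    _ = z * (w * x) * y * x⁻¹ * (y⁻¹ * z⁻¹) * w⁻¹ := by
        rw [hw1 x]
        have : z⁻¹ * y⁻¹ = y⁻¹ * z⁻¹ := by rw [← mul_inv_rev, ← mul_inv_rev, hz1 y]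
        rw [this]
    _ = w * z * (x * y * x⁻¹ * y⁻¹) * z⁻¹ * w⁻¹ := by rw [← hw1 z]; group
    _ = w * (z * z⁻¹) * (x * y * x⁻¹ * y⁻¹) * w⁻¹ := by
        rw [mul_assoc w z, ← hz1]; group
    _ = x * y * x⁻¹ * y⁻¹ := by rw [mul_assoc w, mul_assoc w, ← hw1]; group

variable {K E Q G : Type*} [CommGroup K] [Group E] [Group Q] [CommGroup G]

/-- The antidiagonal copy `c ↦ (φ c⁻¹, c)` of `K` in `G × E`. -/
def antidiag (S : GroupExtension K E Q) (φ : K →* G) : Subgroup (G × E) :=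
  ((φ.comp (invMonoidHom : K →* K)).prod S.inl).range

theorem antidiag_normal (S : GroupExtension K E Q) (hS : S.inl.range ≤ Subgroup.center E)
    (φ : K →* G) : (antidiag S φ).Normal := by
  constructor
  rintro _ ⟨c, rfl⟩ ⟨g, e⟩
  have h : e * S.inl c = S.inl c * e := Subgroup.mem_center_iff.1 (hS ⟨c, rfl⟩) e
  refine ⟨c, ?_⟩
  ext
  · simp
  · simp [h]

/-- The middle group of the extension of `Q` by `G` obtained from an extension of `Q` by `K` by
pushing forward along `φ : K → G`. -/
abbrev PushGroup (S : GroupExtension K E Q) (φ : K →* G) [(antidiag S φ).Normal] :=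
  (G × E) ⧸ antidiag S φ

/-- The extension `1 → G → (G × E) / K → Q → 1` obtained from `1 → K → E → Q → 1` by pushing
forward along `φ : K → G`. -/
def pushExtension (S : GroupExtension K E Q) (φ : K →* G) [(antidiag S φ).Normal] :
    GroupExtension G (PushGroup S φ) Q where
  inl := (QuotientGroup.mk' (antidiag S φ)).comp (MonoidHom.inl G E)
  rightHom := QuotientGroup.lift (antidiag S φ) (S.rightHom.comp (MonoidHom.snd G E)) (by
    rintro _ ⟨c, rfl⟩
    simp)
  inl_injective := by
    rw [injective_iff_map_eq_one]
    intro g hg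
    have hg' : ((g, 1) : G × E) ∈ antidiag S φ := (QuotientGroup.eq_one_iff _).1 hg
    obtain ⟨c, hc⟩ := hg'
    have h1 : φ c⁻¹ = g := congrArg Prod.fst hc
    have h2 : S.inl c = 1 := congrArg Prod.snd hc
    have h3 : c = 1 := S.inl_injective (by rw [h2, map_one])
    rw [← h1, h3, inv_one, map_one]
  range_inl_eq_ker_rightHom := by
    ext x
    obtain ⟨⟨g, e⟩, rfl⟩ := QuotientGroup.mk_surjective x
    constructor
    · rintro ⟨g', hg'⟩
      rw [MonoidHom.mem_ker, ← hg']
      change S.rightHom 1 = 1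
      exact map_one _
    · intro h
      have h : S.rightHom e = 1 := h
      rw [← MonoidHom.mem_ker, ← S.range_inl_eq_ker_rightHom] at h
      obtain ⟨c, rfl⟩ := h
      refine ⟨g * φ c, ?_⟩
      refine QuotientGroup.eq.2 ⟨c, ?_⟩
      ext
      · simp
      · simp
  rightHom_surjective := by
    intro q
    obtain ⟨e, he⟩ := S.rightHom_surjective q
    exact ⟨QuotientGroup.mk (1, e), he⟩

theorem pushExtension_central (S : GroupExtension K E Q) (φ : K →* G) [(antidiag S φ).Normal] :
    (pushExtension S φ).inl.range ≤ Subgroup.center (PushGroup S φ) := by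
  rintro _ ⟨g, rfl⟩
  refine Subgroup.mem_center_iff.2 fun x => ?_
  obtain ⟨⟨g', e⟩, rfl⟩ := QuotientGroup.mk_surjective x
  change QuotientGroup.mk ((g', e) * (g, 1)) = QuotientGroup.mk ((g, 1) * (g', e))
  congr 1
  ext
  · exact mul_comm _ _
  · simp

end Commutator

section Symbols

variable {k : Type u} [Field k] {V : Type v} [AddCommGroup V] [Module k V]

instance (A : Submodule k V) {G : Type*} [CommGroup G] (φ : kˣ →* G) :
    (antidiag (DetExt.extension A) φ).Normal :=
  antidiag_normal _ (DetExt.extension_central A) φ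

/-- The commutator `{σ, τ}` of commuting elements of `GL (V, A)` in the determinantal central
extension `1 → kˣ → DetExt A → GL (V, A) → 1`. -/
noncomputable def comm (A : Submodule k V) {σ τ : ResGL A} (h : Commute σ τ) : kˣ :=
  extCommutator (DetExt.extension A) h

/-- The commutator `{σ, τ}_φ` of commuting elements of `GL (V, A)` in the central extension of
`GL (V, A)` by `G` obtained from the determinantal one by pushing forward along `φ : kˣ → G`. -/
noncomputable def commPush (A : Submodule k V) {G : Type*} [CommGroup G] (φ : kˣ →* G)
    {σ τ : ResGL A} (h : Commute σ τ) : G :=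
  extCommutator (pushExtension (DetExt.extension A) φ) h

/-- The tame symbol `<σ, τ> = (-1) ^ (i(σ) i(τ)) {σ, τ}` of commuting elements of `GL (V, A)`. -/
noncomputable def tame (A : Submodule k V) {σ τ : ResGL A} (h : Commute σ τ) : kˣ :=
  (-1) ^ (index A σ * index A τ) * comm A h

end Symbols

section Families

variable {k : Type u} [Field k] {V : Type v} [AddCommGroup V] [Module k V] {I : Type w}

/-- The restricted linear group `GL (V, {V_i})` of a family of subspaces: the automorphisms which
belong to `GL (V, V_i)` for all `i` and satisfy `σ V_i = V_i` for almost all `i`. -/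
def FamGL (A : I → Submodule k V) : Subgroup (V ≃ₗ[k] V) where
  carrier := {σ | (∀ i, σ ∈ ResGL (A i)) ∧ {i | (A i).map (σ : V →ₗ[k] V) ≠ A i}.Finite}
  mul_mem' := by
    rintro σ τ ⟨hσ, hσ'⟩ ⟨hτ, hτ'⟩
    refine ⟨fun i => mul_mem (hσ i) (hτ i), (hσ'.union hτ').subset ?_⟩
    intro i hi
    by_contra h
    rw [Set.mem_union, not_or] at h
    have h1 : (A i).map (σ : V →ₗ[k] V) = A i := not_not.1 h.1
    have h2 : (A i).map (τ : V →ₗ[k] V) = A i := not_not.1 h.2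
    exact hi (by rw [map_mul_eq, h2, h1])
  one_mem' := by
    refine ⟨fun i => one_mem _, ?_⟩
    convert Set.finite_empty (α := I)
    ext i
    simp
  inv_mem' := by
    rintro σ ⟨hσ, hσ'⟩
    refine ⟨fun i => inv_mem (hσ i), hσ'.subset ?_⟩
    intro i hi h
    apply hi
    have h1 := map_map_inv σ (A i)
    rwa [h] at h1

/-- The restriction of an automorphism of `V` to a subspace `W` with `σ W = W`. -/
def restrict (σ : V ≃ₗ[k] V) (W : Submodule k V) (h : W.map (σ : V →ₗ[k] V) = W) : W ≃ₗ[k] W :=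
  σ.ofSubmodules W W h

theorem commensurable_submoduleOf {A B W : Submodule k V} (hA : A ≤ W) (hB : B ≤ W)
    (h : Commensurable A B) : Commensurable (A.submoduleOf W) (B.submoduleOf W) := by
  obtain ⟨F, hF, h1, h2⟩ := commensurable_iff.1 h
  have hFfin : FiniteDimensional k F := Module.Finite.iff_fg.2 hF
  have key : ∀ {A B : Submodule k V}, A ≤ W → B ≤ W → A ≤ B ⊔ F →
      A.submoduleOf W ≤ B.submoduleOf W ⊔ F.submoduleOf W := by
    intro A B hA hB h x hx
    obtain ⟨b, hb, f, hf, hx'⟩ := Submodule.mem_sup.1 (h hx)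
    have hfW : f ∈ W := by
      have : f = x - b := eq_sub_of_add_eq' hx'
      rw [this]; exact W.sub_mem x.2 (hB hb)
    exact Submodule.mem_sup.2 ⟨⟨b, hB hb⟩, hb, ⟨f, hfW⟩, hf, Subtype.ext hx'⟩
  have hFW : FiniteDimensional k ↥(F.submoduleOf W) := by
    have : Function.Injective ((W.subtype.comp (F.submoduleOf W).subtype).codRestrict F
        (fun x => x.2)) := by
      intro x y hxy
      have := congrArg Subtype.val hxy
      exact Subtype.ext (Subtype.ext this)
    exact FiniteDimensional.of_injective _ this
  exact commensurable_iff.2 ⟨F.submoduleOf W, Module.Finite.iff_fg.1 hFW, key hA hB h1, key hB hA h2⟩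

theorem map_restrict {σ : V ≃ₗ[k] V} {A W : Submodule k V} (hA : A ≤ W)
    (h : W.map (σ : V →ₗ[k] V) = W) :
    (A.submoduleOf W).map (restrict σ W h : W →ₗ[k] W) =
      (A.map (σ : V →ₗ[k] V)).submoduleOf W := by
  ext x
  constructor
  · rintro ⟨y, hy, rfl⟩
    exact ⟨y, hy, rfl⟩
  · rintro ⟨y, hy, hyx⟩
    exact ⟨⟨y, hA hy⟩, hy, Subtype.ext hyx⟩

variable (A W : I → Submodule k V) (hAW : ∀ i, A i ≤ W i)
  (hW : ∀ σ ∈ FamGL A, ∀ i, (W i).map (σ : V →ₗ[k] V) = W i)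

/-- The action of `GL (V, {V_i})` on `W_i`, as a homomorphism to `GL (W_i, V_i)`, for subspaces
`V_i ⊆ W_i` with `σ W_i = W_i`. -/
def localHom (i : I) : FamGL A →* ResGL ((A i).submoduleOf (W i)) where
  toFun σ := ⟨restrict σ.1 (W i) (hW σ.1 σ.2 i), by
    rw [mem_ResGL, map_restrict (hAW i)]
    refine commensurable_submoduleOf ?_ (hAW i) (σ.2.1 i)
    rw [← hW σ.1 σ.2 i]
    exact Submodule.map_mono (hAW i)⟩
  map_one' := rfl
  map_mul' _ _ := rfl

/-- The subspace `∏ V_i` of `∏ W_i`. -/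
def prodSub : Submodule k (∀ i, W i) :=
  Submodule.pi Set.univ (fun i => (A i).submoduleOf (W i))

theorem commensurable_pi {M : I → Type*} [∀ i, AddCommGroup (M i)] [∀ i, Module k (M i)]
    {P Q : ∀ i, Submodule k (M i)} (h : ∀ i, Commensurable (P i) (Q i))
    (hfin : {i | P i ≠ Q i}.Finite) :
    Commensurable (Submodule.pi Set.univ P) (Submodule.pi Set.univ Q) := by
  classical
  choose F hF h1 h2 using fun i => commensurable_iff.1 (h i)
  have key : ∀ P Q : ∀ i, Submodule k (M i), (∀ i, P i ≤ Q i ⊔ F i) →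
      (∀ i, i ∉ hfin.toFinset → P i = Q i) →
      Submodule.pi Set.univ P ≤ Submodule.pi Set.univ Q ⊔
        hfin.toFinset.sup fun i => (F i).map (LinearMap.single k M i) := by
    intro P Q hPQ hS x hx
    have hx : ∀ i, x i ∈ P i := fun i => hx i trivial
    choose q hq f hf hqf using fun i => Submodule.mem_sup.1 (hPQ i (hx i))
    refine Submodule.mem_sup.2 ⟨x - ∑ i ∈ hfin.toFinset, LinearMap.single k M i (f i), ?_,
      ∑ i ∈ hfin.toFinset, LinearMap.single k M i (f i), ?_, sub_add_cancel _ _⟩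
    · intro i _
      rw [Pi.sub_apply, Finset.sum_apply]
      simp only [LinearMap.coe_single]
      by_cases hi : i ∈ hfin.toFinset
      · rw [Finset.sum_eq_single i (fun j _ hj => Pi.single_eq_of_ne hj.symm _)
          (fun h => absurd hi h), Pi.single_eq_same, ← hqf i, add_sub_cancel_right]
        exact hq i
      · rw [Finset.sum_eq_zero (fun j hj => Pi.single_eq_of_ne (by rintro rfl; exact hi hj) _), sub_zero,
          ← hS i hi]
        exact hx i
    · refine Submodule.sum_mem _ fun i hi => ?_
      exact Finset.le_sup (f := fun i => (F i).map (LinearMap.single k M i)) hi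
        (Submodule.mem_map_of_mem (hf i))
  refine commensurable_iff.2 ⟨_, Submodule.fg_finset_sup hfin.toFinset _
    (fun i _ => (hF i).map _), key P Q h1 ?_, key Q P h2 ?_⟩
  · intro i hi
    simpa using hi
  · intro i hi
    have : P i = Q i := by simpa using hi
    exact this.symm

theorem map_pi {M : I → Type*} [∀ i, AddCommGroup (M i)] [∀ i, Module k (M i)]
    (P : ∀ i, Submodule k (M i)) (f : ∀ i, M i ≃ₗ[k] M i) :
    (Submodule.pi Set.univ P).map (LinearEquiv.piCongrRight f : (∀ i, M i) →ₗ[k] ∀ i, M i) =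
      Submodule.pi Set.univ (fun i => (P i).map (f i : M i →ₗ[k] M i)) := by
  ext x
  constructor
  · rintro ⟨y, hy, rfl⟩ i _
    exact ⟨y i, hy i trivial, rfl⟩
  · intro hx
    choose y hy hyx using fun i => hx i trivial
    exact ⟨y, fun i _ => hy i, funext hyx⟩

/-- The diagonal action of `GL (V, {V_i})` on `∏ W_i`, as a homomorphism to
`GL (∏ W_i, ∏ V_i)`. -/
def globalHom : FamGL A →* ResGL (prodSub A W) where
  toFun σ := ⟨LinearEquiv.piCongrRight fun i => restrict σ.1 (W i) (hW σ.1 σ.2 i), by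
    rw [mem_ResGL, prodSub, map_pi]
    refine commensurable_pi (fun i => (localHom A W hAW hW i σ).2) (σ.2.2.subset ?_)
    intro i hi h
    apply hi
    rw [map_restrict (hAW i), h]⟩
  map_one' := rfl
  map_mul' _ _ := rfl

end Families
end TameSymbol

/-! Let S be the finite set of indices i at which σ or τ moves V_i. For T ⊆ I let σ_T act as σ on
the factors W_i with i ∈ T and as the identity on the others (`partialGL`). The diagonal action of σ
is then σ_S times σ_{I∖S}, and σ_S is a finite product of the σ_{i}; the same holds for τ.

The tame symbol, unlike the bare commutator, is multiplicative along such decompositions. As the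
extension is central, the commutator is bimultiplicative, so for disjoint T and T' the commutator of
σ_T σ_T' with τ_T τ_T' contains, besides {σ_T, τ_T} and {σ_T', τ_T'}, two cross terms {σ_T, τ_T'}
and {σ_T', τ_T}. These pairs act on independent parts of the product, but their commutators need not
be 1: moving vectors of one part past vectors of the other in a wedge product leaves the sign (-1) ^
(i(σ_T) i(τ_T')), and likewise for the other pair (`comm_of_disjoint`). The index is additive, so
the mixed terms of i(σ) i(τ) produce the same signs once more, and everything mixed cancels
(`tame_mul_mul`).

It remains to evaluate the pieces. A single factor gives the local symbol, because adding a summand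
on which both automorphisms are trivial changes neither index nor commutator
(`tame_eq_of_embedding`). Off S both automorphisms preserve the subspace, and the symbol is 1
(`tame_eq_one`). Finally, pushing the extension forward along φ applies φ to commutators
(`commPush_eq`).

All commutators are computed in frames: for lifts x, y of σ, τ the equation {σ, τ} y x = x y becomes
an identity between products of scalars (`comm_mul_apply`). -/

namespace TameSymbol

universe u v w

/-! ### Frames and wedge products: signs, injections, adding a complement. -/

section Frames

variable {k : Type u} [Field k] {V : Type v} [AddCommGroup V] [Module k V]
  {U : Type*} [AddCommGroup U] [Module k U]

theorem ι_mul_wedge (N : Submodule k V) (x : V) (l : List V) :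
    ExteriorAlgebra.ι k (N.mkQ x) * wedge N l =
      (-1 : kˣ) ^ l.length • (wedge N l * ExteriorAlgebra.ι k (N.mkQ x)) := by
  induction l with
  | nil => simp [wedge_nil]
  | cons y l ih =>
    have h := ExteriorAlgebra.ι_add_mul_swap (R := k) (N.mkQ x) (N.mkQ y)
    rw [wedge_cons, ← mul_assoc, eq_neg_of_add_eq_zero_left h, neg_mul, mul_assoc, ih,
      mul_smul_comm, List.length_cons, pow_succ', mul_smul, mul_assoc]
    simp [Units.smul_def]

theorem wedge_append_comm (N : Submodule k V) (l l' : List V) :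
    wedge N (l ++ l') = (-1 : kˣ) ^ (l.length * l'.length) • wedge N (l' ++ l) := by
  induction l with
  | nil => simp
  | cons x l ih =>
    rw [List.cons_append, wedge_cons, ih, mul_smul_comm, wedge_append, ← mul_assoc, ι_mul_wedge,
      smul_mul_assoc, smul_smul, mul_assoc, ← wedge_cons, ← wedge_append, ← pow_add,
      List.length_cons, Nat.succ_mul]

theorem wedge_map_smul {N : Submodule k U} {N' : Submodule k V} (f : U →ₗ[k] V)
    (hf : N ≤ N'.comap f) {l l' : List U} {r : kˣ} (h : wedge N l' = r • wedge N l) :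
    wedge N' (l'.map f) = r • wedge N' (l.map f) := by
  have key : ∀ l : List U, wedge N' (l.map f) =
      ExteriorAlgebra.map (N.mapQ N' f hf) (wedge N l) := by
    intro l
    induction l with
    | nil => simp [wedge_nil]
    | cons x l ih =>
      rw [List.map_cons, wedge_cons, wedge_cons, ih, map_mul, ExteriorAlgebra.map_apply_ι]
      simp
  rw [key, key, h, Units.smul_def, Units.smul_def, map_smul]

theorem IsFrame.map_injective {N B : Submodule k U} {l : List U} (h : IsFrame N B l)
    {ι : U →ₗ[k] V} (hι : Function.Injective ι) : IsFrame (N.map ι) (B.map ι) (l.map ι) := by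
  refine ⟨?_, ?_⟩
  · have hker : LinearMap.ker (N.mapQ (N.map ι) ι (Submodule.le_comap_map ι N)) = ⊥ := by
      rw [Submodule.ker_mapQ, Submodule.comap_map_eq_of_injective hι]
      simp
    refine (linearIndependent_equiv' (finCongr (List.length_map (f := ι) (as := l)).symm)
      ?_).1 (h.indep.map' _ hker)
    funext i
    simp
  · rw [← h.span, Submodule.map_sup, Submodule.map_span]
    congr 2
    ext x
    simp

/-- Since B ∩ D = 0 and N ≤ B, one has B ∩ (N ⊕ D) = N, so V / N → V / (N ⊕ D) is injective on B /
N. This is how frames of one summand become frames in the whole space. -/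
theorem IsFrame.sup_right {N B : Submodule k V} {l : List V} (h : IsFrame N B l)
    {D : Submodule k V} (hD : Disjoint B D) : IsFrame (N ⊔ D) (B ⊔ D) l := by
  refine ⟨?_, by rw [← sup_assoc, h.span]⟩
  refine h.indep.map (f := Submodule.factor (le_sup_left : N ≤ N ⊔ D)) ?_
  rw [h.span_range, Submodule.disjoint_def]
  rintro _ ⟨x, hx, rfl⟩ h0
  have h1 : x ∈ N ⊔ D := by simpa using h0
  obtain ⟨n, hn, d, hd, rfl⟩ := Submodule.mem_sup.1 h1
  have h2 : d = 0 := Submodule.disjoint_def.1 hD d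
    (by simpa using B.sub_mem hx (h.le hn)) hd
  simpa [h2] using hn

theorem IsFrame.sup_left {N B : Submodule k V} {l : List V} (h : IsFrame N B l)
    {D : Submodule k V} (hD : Disjoint D B) : IsFrame (D ⊔ N) (D ⊔ B) l := by
  rw [sup_comm D, sup_comm D]
  exact h.sup_right hD.symm

theorem IsFrame.append_comm {N B : Submodule k V} {l l' : List V} (h : IsFrame N B (l ++ l')) :
    IsFrame N B (l' ++ l) := by
  refine ⟨?_, ?_⟩
  · refine (linearIndependent_equiv' ((finCongr List.length_append).trans
      (finSumFinEquiv.symm.trans ((Equiv.sumComm _ _).trans (finSumFinEquiv.trans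
        (finCongr List.length_append.symm))))) ?_).2 h.indep
    funext i
    obtain ⟨j, rfl⟩ := (finSumFinEquiv.trans (finCongr List.length_append.symm)).surjective i
    rcases j with j | j <;> simp
  · rw [← h.span]
    congr 2
    ext x
    simp [or_comm]

theorem IsFrame.finrank_eq {N B : Submodule k V} {l : List V} (h : IsFrame N B l) :
    Module.finrank k (↥B ⧸ N.submoduleOf B) = l.length := by
  have hker : LinearMap.ker (N.mkQ.comp B.subtype) = N.submoduleOf B := by
    rw [LinearMap.ker_comp, Submodule.ker_mkQ]
    rfl
  have hrange : LinearMap.range (N.mkQ.comp B.subtype) = B.map N.mkQ := by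
    rw [LinearMap.range_comp, Submodule.range_subtype]
  have e := (Submodule.quotEquivOfEq _ _ hker.symm).trans
    ((N.mkQ.comp B.subtype).quotKerEquivRange.trans (LinearEquiv.ofEq _ _ hrange))
  rw [e.finrank_eq, Module.finrank_eq_card_basis h.basis, Fintype.card_fin]

/-- The rule `append` cancels a common prefix without a sign. A common suffix `e` must first be
carried to the front, past `c` on one side and past `b` on the other. This Koszul sign is the origin
of the sign in the tame symbol. -/
theorem DetIso.swap_apply {C B N : Submodule k V} (a : DetIso C B) {c b e : List V}
    (hc : IsFrame N C (e ++ c)) (hb : IsFrame N B (e ++ b)) :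
    a.toFun N (c ++ e) (b ++ e) =
      (-1) ^ (e.length * (c.length + b.length)) * a.toFun N (e ++ c) (e ++ b) := by
  rw [a.smul_left hc hc.append_comm hb.append_comm (wedge_append_comm N c e),
    a.smul_right hc hb.append_comm hb (wedge_append_comm N e b), mul_add, pow_add,
    mul_comm e.length c.length, mul_assoc, mul_comm (a.toFun _ _ _)]

end Frames

/-! ### Index, commutator and tame symbol over a single subspace. -/

section Extension

variable {k : Type u} [Field k] {V : Type v} [AddCommGroup V] [Module k V] {A : Submodule k V}

/-- The index may be read off over any common subspace of finite codimension, not only over A ∩ f A.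
-/
theorem index_eq {f : ResGL A} {N : Submodule k V} {b c : List V} (hb : IsFrame N A b)
    (hc : IsFrame N (A.map (f.1 : V →ₗ[k] V)) c) : index A f = b.length - c.length := by
  have hN : N ≤ A ⊓ A.map (f.1 : V →ₗ[k] V) := le_inf hb.le hc.le
  have h1 : Commensurable A (A ⊓ A.map (f.1 : V →ₗ[k] V)) := (Commensurable.refl A).inf f.2.symm
  obtain ⟨b', hb'⟩ := h1.symm.exists_isFrame inf_le_left
  obtain ⟨c', hc'⟩ := (h1.symm.trans f.2.symm).exists_isFrame inf_le_right
  -- A frame of (A ∩ f A) / N adds the same number of vectors on both sides and cancels in the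
  -- difference.
  obtain ⟨u, hu⟩ := (hb.commensurable.trans h1).exists_isFrame hN
  have e1 := hb.length_eq (hu.append hb')
  have e2 := hc.length_eq (hu.append hc')
  rw [List.length_append] at e1 e2
  rw [index, hb'.finrank_eq, hc'.finrank_eq, e1, e2]
  push_cast
  ring

theorem index_mul (f g : ResGL A) : index A (f * g) = index A f + index A g := by
  obtain ⟨N, b, c, d, hb, hc, hd⟩ := DetExt.exists_frames f (f * g)
  have hd' := hd
  rw [Subgroup.coe_mul, map_mul_eq, ← isFrame_comap_iff] at hd'
  rw [index_eq hb hd, index_eq hb hc, index_eq ((isFrame_comap_iff f.1).2 hc) hd',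
    List.length_map, List.length_map]
  ring

theorem index_eq_zero {f : ResGL A} (hf : A.map (f.1 : V →ₗ[k] V) = A) : index A f = 0 := by
  have h : IsFrame A (A.map (f.1 : V →ₗ[k] V)) [] := by
    rw [hf]; exact IsFrame.nil A
  rw [index_eq (IsFrame.nil A) h, sub_self]

theorem incl_comm_mul {σ τ : ResGL A} (h : Commute σ τ) {x y : DetExt A} (hx : x.toGL = σ)
    (hy : y.toGL = τ) : DetExt.incl A (comm A h) * (y * x) = x * y := by
  have h1 : DetExt.incl A (comm A h) = x * y * x⁻¹ * y⁻¹ :=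
    inl_extCommutator (DetExt.extension A) (DetExt.extension_central A) h hx hy
  rw [h1]
  group

theorem comm_eq_of_incl {σ τ : ResGL A} (h : Commute σ τ) {x y : DetExt A} (hx : x.toGL = σ)
    (hy : y.toGL = τ) {r : kˣ} (hr : DetExt.incl A r * (y * x) = x * y) : comm A h = r := by
  rw [← incl_comm_mul h hx hy] at hr
  exact ((DetExt.extension A).inl_injective (mul_right_cancel hr)).symm

theorem exists_lift (σ : ResGL A) : ∃ x : DetExt A, x.toGL = σ :=
  (DetExt.extension A).rightHom_surjective σ

/-- In any group [x x', y] = x [x', y] x⁻¹ [x, y]; here [x', y] is central, so the conjugation by x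
disappears. -/
theorem comm_mul_left {σ σ' τ : ResGL A} (h : Commute σ τ) (h' : Commute σ' τ) :
    comm A (h.mul_left h') = comm A h * comm A h' := by
  obtain ⟨x, hx⟩ := exists_lift σ
  obtain ⟨x', hx'⟩ := exists_lift σ'
  obtain ⟨y, hy⟩ := exists_lift τ
  refine comm_eq_of_incl _ (x := x * x') (y := y) (by rw [DetExt.toGL_mul, hx, hx']) hy ?_
  calc DetExt.incl A (comm A h * comm A h') * (y * (x * x'))
      = DetExt.incl A (comm A h') * (DetExt.incl A (comm A h) * (y * x)) * x' := by
        rw [mul_comm (comm A h), map_mul]; simp only [mul_assoc]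
    _ = DetExt.incl A (comm A h') * x * y * x' := by rw [incl_comm_mul h hx hy, mul_assoc _ x y]
    _ = x * (DetExt.incl A (comm A h') * (y * x')) := by
        rw [DetExt.incl_central]; simp only [mul_assoc]
    _ = x * x' * y := by rw [incl_comm_mul h' hx' hy, mul_assoc]

theorem comm_mul_right {σ τ τ' : ResGL A} (h : Commute σ τ) (h' : Commute σ τ') :
    comm A (h.mul_right h') = comm A h * comm A h' := by
  obtain ⟨x, hx⟩ := exists_lift σ
  obtain ⟨y, hy⟩ := exists_lift τ
  obtain ⟨y', hy'⟩ := exists_lift τ'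
  refine comm_eq_of_incl _ (x := x) (y := y * y') hx (by rw [DetExt.toGL_mul, hy, hy']) ?_
  calc DetExt.incl A (comm A h * comm A h') * (y * y' * x)
      = DetExt.incl A (comm A h) * (DetExt.incl A (comm A h') * y) * (y' * x) := by
        rw [map_mul]; simp only [mul_assoc]
    _ = DetExt.incl A (comm A h) * y * (DetExt.incl A (comm A h') * (y' * x)) := by
        rw [DetExt.incl_central (comm A h') y]; simp only [mul_assoc]
    _ = DetExt.incl A (comm A h) * (y * x) * y' := by
        rw [incl_comm_mul h' hx hy']; simp only [mul_assoc]
    _ = x * (y * y') := by rw [incl_comm_mul h hx hy, mul_assoc]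

/-- The equation {σ, τ} y x = x y in coordinates. Both sides are isomorphisms det (στA) → det A; one
factors through det (τA), the other through det (σA), and the single frame `d` serves both because
στA = τσA. -/
theorem comm_mul_apply {σ τ : ResGL A} (h : Commute σ τ) {x y : DetExt A} (hx : x.toGL = σ)
    (hy : y.toGL = τ) {N : Submodule k V} {b c c' d : List V} (hb : IsFrame N A b)
    (hc : IsFrame N (A.map (σ.1 : V →ₗ[k] V)) c) (hc' : IsFrame N (A.map (τ.1 : V →ₗ[k] V)) c')
    (hd : IsFrame N (A.map ((σ * τ).1 : V →ₗ[k] V)) d) :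
    comm A h * (y.det.toFun N c' b *
        x.det.toFun (N.comap (τ.1 : V →ₗ[k] V)) (d.map τ.1.symm) (c'.map τ.1.symm)) =
      x.det.toFun N c b *
        y.det.toFun (N.comap (σ.1 : V →ₗ[k] V)) (d.map σ.1.symm) (c.map σ.1.symm) := by
  subst hx hy
  have hd' : IsFrame N (A.map ((y * x).toGL.1 : V →ₗ[k] V)) d := by
    rw [DetExt.toGL_mul, ← h.eq]; exact hd
  rw [← DetExt.mul_apply y x hb hc' hd', ← DetExt.mul_apply x y hb hc hd,
    ← DetExt.incl_mul_apply _ _ hb hd', incl_comm_mul h rfl rfl]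

/-- When A is preserved one may take N = A with empty frames. Both sides of `comm_mul_apply` then
involve the same two scalars, in opposite orders. -/
theorem comm_eq_one {σ τ : ResGL A} (h : Commute σ τ) (hσ : A.map (σ.1 : V →ₗ[k] V) = A)
    (hτ : A.map (τ.1 : V →ₗ[k] V) = A) : comm A h = 1 := by
  obtain ⟨x, hx⟩ := exists_lift σ
  obtain ⟨y, hy⟩ := exists_lift τ
  have hn := IsFrame.nil A
  have h1 := comm_mul_apply h hx hy hn (c := []) (c' := []) (d := []) (by rwa [hσ]) (by rwa [hτ])
    (by rwa [Subgroup.coe_mul, map_mul_eq, hτ, hσ])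
  have hσ' : A.comap (σ.1 : V →ₗ[k] V) = A := by
    exact (congrArg (Submodule.comap (σ.1 : V →ₗ[k] V)) hσ.symm).trans
      (Submodule.comap_map_eq_of_injective σ.1.injective A)
  have hτ' : A.comap (τ.1 : V →ₗ[k] V) = A := by
    exact (congrArg (Submodule.comap (τ.1 : V →ₗ[k] V)) hτ.symm).trans
      (Submodule.comap_map_eq_of_injective τ.1.injective A)
  simp only [List.map_nil, hσ', hτ'] at h1
  rw [mul_comm (y.det.toFun _ _ _)] at h1
  exact mul_eq_right.1 h1

theorem tame_eq_one {σ τ : ResGL A} (h : Commute σ τ) (hσ : A.map (σ.1 : V →ₗ[k] V) = A)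
    (hτ : A.map (τ.1 : V →ₗ[k] V) = A) : tame A h = 1 := by
  rw [tame, comm_eq_one h hσ hτ, index_eq_zero hσ]
  simp

/-- The tame symbol is multiplicative over commuting pairs whose cross commutators are given by
the sign rule. -/
theorem tame_mul_mul {σ σ' τ τ' F H : ResGL A} (h : Commute σ τ) (h' : Commute σ' τ')
    (h₁ : Commute σ τ') (h₂ : Commute σ' τ) (hF : F = σ * σ') (hH : H = τ * τ') (hFH : Commute F H)
    (hc₁ : comm A h₁ = (-1) ^ (index A σ * index A τ'))
    (hc₂ : comm A h₂ = (-1) ^ (index A σ' * index A τ)) :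
    tame A hFH = tame A h * tame A h' := by
  subst hF hH
  have e : comm A hFH = comm A ((h.mul_right h₁).mul_left (h₂.mul_right h')) := rfl
  rw [tame, tame, tame, e, comm_mul_left (h.mul_right h₁) (h₂.mul_right h'), comm_mul_right h h₁,
    comm_mul_right h₂ h', hc₁, hc₂, index_mul,
    index_mul]
  -- The mixed terms ad + cb occur twice, once from the product of the indices and once from the
  -- cross commutators, so their total exponent is even.
  have e2 : ∀ a b c d : ℤ, (-1 : kˣ) ^ ((a + c) * (b + d)) * ((-1) ^ (a * d) * (-1) ^ (c * b)) =
      (-1) ^ (a * b) * (-1) ^ (c * d) := by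
    intro a b c d
    have s : (-1 : kˣ) ^ ((a * d + c * b) + (a * d + c * b)) = 1 :=
      Even.neg_one_zpow ⟨_, rfl⟩
    rw [← zpow_add, ← zpow_add, ← zpow_add, show (a + c) * (b + d) + (a * d + c * b) =
      (a * b + c * d) + ((a * d + c * b) + (a * d + c * b)) by ring, zpow_add _ (a * b + c * d), s,
      mul_one]
  have e3 := e2 (index A σ) (index A τ) (index A σ') (index A τ')
  rw [mul_mul_mul_comm (_ ^ (index A σ * index A τ)), ← e3, mul_assoc, mul_assoc, mul_assoc]
  congr 1
  ac_rfl

/-- If x, y lift σ, τ, then (1, x) and (1, y) lift them to the pushed-out extension. Their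
commutator is the class of (1, c) with c = {σ, τ} in kˣ, and modulo the antidiagonal this is the
class of (φ c, 1). -/
theorem commPush_eq {G : Type*} [CommGroup G] (φ : kˣ →* G) {σ τ : ResGL A} (h : Commute σ τ) :
    commPush A φ h = φ (comm A h) := by
  obtain ⟨x, hx⟩ := exists_lift σ
  obtain ⟨y, hy⟩ := exists_lift τ
  let S := DetExt.extension A
  apply (pushExtension S φ).inl_injective
  have h1 := inl_extCommutator (pushExtension S φ) (pushExtension_central S φ) h
    (x := QuotientGroup.mk (1, x)) (y := QuotientGroup.mk (1, y)) hx hy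
  have h2 : DetExt.incl A (comm A h) = x * y * x⁻¹ * y⁻¹ :=
    inl_extCommutator S (DetExt.extension_central A) h hx hy
  refine h1.trans ?_
  change (QuotientGroup.mk ((1, x) * (1, y) * (1, x)⁻¹ * (1, y)⁻¹ : G × DetExt A) : PushGroup S φ) =
    QuotientGroup.mk (φ (comm A h), 1)
  -- The antidiagonal is c ↦ (φ c⁻¹, c), so the inverse of the commutator is what gives φ of the
  -- commutator in the first coordinate.
  refine QuotientGroup.eq.2 ⟨(comm A h)⁻¹, ?_⟩
  ext
  · simp
  · change DetExt.incl A (comm A h)⁻¹ = (x * y * x⁻¹ * y⁻¹)⁻¹ * 1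
    rw [map_inv, h2, mul_one]

end Extension

/-! ### Automorphisms acting on independent parts: the sign rule. -/

section Disjoint

variable {k : Type u} [Field k] {V : Type v} [AddCommGroup V] [Module k V]

theorem map_eq_of_fixed {f : V ≃ₗ[k] V} {D E : Submodule k V} (hf : ∀ v ∈ E, f v = v)
    (hD : D ≤ E) : D.map (f : V →ₗ[k] V) = D := by
  ext x
  constructor
  · rintro ⟨y, hy, rfl⟩
    have h : (f : V →ₗ[k] V) y = y := hf y (hD hy)
    rwa [h]
  · intro hx
    exact ⟨x, hx, hf x (hD hx)⟩

theorem symm_fixed {f : V ≃ₗ[k] V} {D : Submodule k V} (hf : ∀ v ∈ D, f v = v) :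
    ∀ v ∈ D, f.symm v = v :=
  fun v hv => by rw [LinearEquiv.symm_apply_eq, hf v hv]

theorem IsFrame.map_eq_of_fixed {f : V ≃ₗ[k] V} {N B D : Submodule k V} {l : List V}
    (h : IsFrame N B l) (hB : B ≤ D) (hf : ∀ v ∈ D, f v = v) : l.map f.symm = l := by
  conv_rhs => rw [← List.map_id l]
  exact List.map_congr_left fun v hv => symm_fixed hf v (hB (h.mem hv))

theorem comap_sup_of_fixed {f : V ≃ₗ[k] V} {N D E : Submodule k V} (hf : ∀ v ∈ E, f v = v)
    (hD : D ≤ E) : (N ⊔ D).comap (f : V →ₗ[k] V) = N.comap (f : V →ₗ[k] V) ⊔ D := by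
  rw [Submodule.comap_equiv_eq_map_symm, Submodule.comap_equiv_eq_map_symm, Submodule.map_sup,
    TameSymbol.map_eq_of_fixed (symm_fixed hf) hD]

/-- The commutator of two automorphisms acting on independent parts of `V`. -/
theorem comm_of_disjoint {A A₁ A₂ V₁ V₂ : Submodule k V} (hA : A = A₁ ⊔ A₂)
    (hV : Disjoint V₁ V₂) (hA₁ : A₁ ≤ V₁) (hA₂ : A₂ ≤ V₂) {σ τ : ResGL A} (h : Commute σ τ)
    (hσ₁ : A₁.map (σ.1 : V →ₗ[k] V) ≤ V₁) (hτ₂ : A₂.map (τ.1 : V →ₗ[k] V) ≤ V₂)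
    (hσ : ∀ v ∈ V₂, σ.1 v = v) (hτ : ∀ v ∈ V₁, τ.1 v = v)
    (h₁ : Commensurable (A₁.map (σ.1 : V →ₗ[k] V)) A₁)
    (h₂ : Commensurable (A₂.map (τ.1 : V →ₗ[k] V)) A₂) :
    comm A h = (-1) ^ (index A σ * index A τ) := by
  obtain ⟨x, rfl⟩ := exists_lift σ
  obtain ⟨y, rfl⟩ := exists_lift τ
  -- Frames are chosen separately in the two parts: `b₁`, `c₁` for A₁, σA₁ over N₁, and `b₂`, `c₂`
  -- for A₂, τA₂ over N₂. All values are then taken over N₁ ⊕ N₂.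
  obtain ⟨N₁, b₁, c₁, -, hb₁, hc₁, -⟩ := DetIso.exists_common h₁.symm h₁.symm
  obtain ⟨N₂, b₂, c₂, -, hb₂, hc₂, -⟩ := DetIso.exists_common h₂.symm h₂.symm
  have hN₁ : N₁ ≤ V₁ := hb₁.le.trans hA₁
  have hN₂ : N₂ ≤ V₂ := hb₂.le.trans hA₂
  have mσ : A.map (x.toGL.1 : V →ₗ[k] V) = A₁.map (x.toGL.1 : V →ₗ[k] V) ⊔ A₂ := by
    conv_lhs => rw [congrArg (Submodule.map (x.toGL.1 : V →ₗ[k] V)) hA]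
    rw [Submodule.map_sup, map_eq_of_fixed hσ hA₂]
  have mτ : A.map (y.toGL.1 : V →ₗ[k] V) = A₁ ⊔ A₂.map (y.toGL.1 : V →ₗ[k] V) := by
    conv_lhs => rw [congrArg (Submodule.map (y.toGL.1 : V →ₗ[k] V)) hA]
    rw [Submodule.map_sup, map_eq_of_fixed hτ hA₁]
  have mστ : A.map ((x.toGL * y.toGL).1 : V →ₗ[k] V) =
      A₁.map (x.toGL.1 : V →ₗ[k] V) ⊔ A₂.map (y.toGL.1 : V →ₗ[k] V) := by
    rw [Subgroup.coe_mul, map_mul_eq, mτ, Submodule.map_sup, map_eq_of_fixed hσ hτ₂]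
  have cσ := comap_sup_of_fixed (N := N₁) hσ hN₂
  have cτ := comap_sup_of_fixed (N := N₂) hτ hN₁
  have hσc₁ := (isFrame_comap_iff x.toGL.1).2 hc₁
  have hτc₂ := (isFrame_comap_iff y.toGL.1).2 hc₂
  have lc₁ := hc₁.map_eq_of_fixed hσ₁ hτ
  have lb₁ := hb₁.map_eq_of_fixed hA₁ hτ
  have lc₂ := hc₂.map_eq_of_fixed hτ₂ hσ
  have lb₂ := hb₂.map_eq_of_fixed hA₂ hσ
  -- The lift of σ changes only the first part. The vectors `u` of the second part stand in front,
  -- so they cancel without a sign, and the value is independent of `u`.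
  have fx : ∀ {N u}, IsFrame N A₂ u → x.det.toFun (N₁ ⊔ N) (u ++ c₁) (u ++ b₁) =
      x.det.toFun (N₁ ⊔ A₂) c₁ b₁ := fun {N u} hu =>
    x.det.append (hu.sup_left (hV.mono hN₁ hA₂))
      (by rw [mσ]; exact hc₁.sup_right (hV.mono hσ₁ hA₂))
      (by rw [hA]; exact hb₁.sup_right (hV.mono hA₁ hA₂))
  -- For the lift of τ the unchanged vectors `u` stand at the end. Cancelling them costs a sign
  -- depending on the length of `u`.
  have fy : ∀ {N u}, IsFrame N A₁ u → y.det.toFun (N ⊔ N₂) (c₂ ++ u) (b₂ ++ u) =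
      (-1) ^ (u.length * (c₂.length + b₂.length)) * y.det.toFun (A₁ ⊔ N₂) c₂ b₂ := by
    intro N u hu
    have f1 : IsFrame (N ⊔ N₂) (A₁ ⊔ N₂) u := hu.sup_right (hV.mono hA₁ hN₂)
    have f2 : IsFrame (A₁ ⊔ N₂) (A.map (y.toGL.1 : V →ₗ[k] V)) c₂ := by
      rw [mτ]; exact hc₂.sup_left (hV.mono hA₁ hτ₂)
    have f3 : IsFrame (A₁ ⊔ N₂) A b₂ := by
      rw [congrArg (IsFrame _) hA]; exact hb₂.sup_left (hV.mono hA₁ hA₂)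
    rw [y.det.swap_apply (f1.append f2) (f1.append f3), y.det.append f1 f2 f3]
  -- All four frames of A, σA, τA and στA list the second part before the first; `fx` and `fy` rely
  -- on this fixed order.
  have F : ∀ {B₁ B₂ l₁ l₂}, IsFrame N₁ B₁ l₁ → IsFrame N₂ B₂ l₂ → B₁ ≤ V₁ → B₂ ≤ V₂ →
      IsFrame (N₁ ⊔ N₂) (B₁ ⊔ B₂) (l₂ ++ l₁) := fun hl₁ hl₂ hB₁ hB₂ =>
    (hl₂.sup_left (hV.mono hN₁ hB₂)).append (hl₁.sup_right (hV.mono hB₁ hB₂))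
  have gb : IsFrame (N₁ ⊔ N₂) A (b₂ ++ b₁) := by
    rw [congrArg (IsFrame _) hA]; exact F hb₁ hb₂ hA₁ hA₂
  have gc : IsFrame (N₁ ⊔ N₂) (A.map (x.toGL.1 : V →ₗ[k] V)) (b₂ ++ c₁) := by
    rw [mσ]; exact F hc₁ hb₂ hσ₁ hA₂
  have gc' : IsFrame (N₁ ⊔ N₂) (A.map (y.toGL.1 : V →ₗ[k] V)) (c₂ ++ b₁) := by
    rw [mτ]; exact F hb₁ hc₂ hA₁ hτ₂
  have gd : IsFrame (N₁ ⊔ N₂) (A.map ((x.toGL * y.toGL).1 : V →ₗ[k] V)) (c₂ ++ c₁) := by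
    rw [mστ]; exact F hc₁ hc₂ hσ₁ hτ₂
  have key := comm_mul_apply h rfl rfl gb gc gc' gd
  rw [sup_comm N₂ N₁, sup_comm _ N₁] at cτ
  rw [cσ, cτ, List.map_append, List.map_append, List.map_append, List.map_append, lc₁, lb₁, lc₂,
    lb₂, fx hb₂, fx hτc₂, fy hb₁, fy hσc₁, List.length_map] at key
  rw [index_eq gb gc, index_eq gb gc', List.length_append, List.length_append, List.length_append]
  generalize comm A h = r at key ⊢
  generalize x.det.toFun _ _ _ = X at key
  generalize y.det.toFun _ _ _ = Y at key
  -- The values X and Y of the two lifts occur on both sides and cancel. Only the signs remain: `fy`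
  -- is used with u = `b₁` on the left, and on the right with the preimage of `c₁` under σ.
  have e : r * (-1) ^ (b₁.length * (c₂.length + b₂.length)) =
      (-1) ^ (c₁.length * (c₂.length + b₂.length)) := by
    apply mul_right_cancel (b := Y * X)
    rw [mul_assoc, ← mul_assoc _ Y X, key]
    ac_rfl
  rw [eq_mul_inv_of_mul_eq e, ← zpow_natCast, ← zpow_natCast, ← zpow_neg, ← zpow_add]
  -- With b₁, b₂, c₁, c₂ standing for the lengths, the sign found has exponent (c₁ - b₁)(c₂ + b₂),
  -- while the indices are b₁ - c₁ and b₂ - c₂. The exponents differ by 2 (c₁ - b₁) b₂.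
  have s : (-1 : kˣ) ^ (((c₁.length - b₁.length) * b₂.length : ℤ) +
      (c₁.length - b₁.length) * b₂.length) = 1 := Even.neg_one_zpow ⟨_, rfl⟩
  refine Eq.trans ?_ (mul_eq_left.2 s)
  rw [← zpow_add]
  congr 1
  push_cast
  ring

end Disjoint

/-! ### Invariance under adding a summand on which both automorphisms are trivial. -/

section Embedding

variable {k : Type u} [Field k] {V : Type v} [AddCommGroup V] [Module k V]
  {U : Type w} [AddCommGroup U] [Module k U]

theorem IsFrame.map_sup {ι : U →ₗ[k] V} (hι : Function.Injective ι) {D : Submodule k V}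
    (hD : Disjoint (LinearMap.range ι) D) {N B : Submodule k U} {l : List U} (h : IsFrame N B l) :
    IsFrame (N.map ι ⊔ D) (B.map ι ⊔ D) (l.map ι) :=
  (h.map_injective hι).sup_right (hD.mono_left LinearMap.map_le_range)

open Classical in
/-- Restriction of an isomorphism of determinant lines along an embedding `ι : U → V`, for
subspaces of the form `ι B ⊕ D`. -/
noncomputable def DetIso.pullback {ι : U →ₗ[k] V} (hι : Function.Injective ι) {D : Submodule k V}
    (hD : Disjoint (LinearMap.range ι) D) {B C : Submodule k U} {B' C' : Submodule k V}
    (hB : B' = B.map ι ⊔ D) (hC : C' = C.map ι ⊔ D) (a : DetIso C' B') : DetIso C B where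
  -- Outside frames the value must be 1 by `eq_one`, and the value of `a` there is not controlled by
  -- that of the images under ι; hence the case distinction.
  toFun N c b := if IsFrame N C c ∧ IsFrame N B b then
    a.toFun (N.map ι ⊔ D) (c.map ι) (b.map ι) else 1
  smul_left := by
    intro N c c' b r hc hc' hb h
    rw [if_pos ⟨hc', hb⟩, if_pos ⟨hc, hb⟩]
    subst hB hC
    exact a.smul_left (hc.map_sup hι hD) (hc'.map_sup hι hD) (hb.map_sup hι hD)
      (wedge_map_smul ι (Submodule.map_le_iff_le_comap.1 le_sup_left) h)
  smul_right := by
    intro N c b b' r hc hb hb' h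
    rw [if_pos ⟨hc, hb⟩, if_pos ⟨hc, hb'⟩]
    subst hB hC
    exact a.smul_right (hc.map_sup hι hD) (hb.map_sup hι hD) (hb'.map_sup hι hD)
      (wedge_map_smul ι (Submodule.map_le_iff_le_comap.1 le_sup_left) h)
  append := by
    intro M N u c b hu hc hb
    rw [if_pos ⟨hu.append hc, hu.append hb⟩, if_pos ⟨hc, hb⟩, List.map_append, List.map_append]
    subst hB hC
    exact a.append (hu.map_sup hι hD) (hc.map_sup hι hD) (hb.map_sup hι hD)
  eq_one := fun h => if_neg h

theorem map_sup_of_semiconj {ι : U →ₗ[k] V} {D : Submodule k V} {f : V ≃ₗ[k] V} {f₁ : U ≃ₗ[k] U}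
    (hf : ∀ u, f (ι u) = ι (f₁ u)) (hfD : ∀ v ∈ D, f v = v) (B : Submodule k U) :
    (B.map ι ⊔ D).map (f : V →ₗ[k] V) = (B.map (f₁ : U →ₗ[k] U)).map ι ⊔ D := by
  have h : (f : V →ₗ[k] V) ∘ₗ ι = ι ∘ₗ (f₁ : U →ₗ[k] U) := LinearMap.ext hf
  rw [Submodule.map_sup, map_eq_of_fixed hfD le_rfl, ← Submodule.map_comp, ← Submodule.map_comp, h]

theorem semiconj_symm {ι : U →ₗ[k] V} {f : V ≃ₗ[k] V} {f₁ : U ≃ₗ[k] U}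
    (hf : ∀ u, f (ι u) = ι (f₁ u)) (u : U) : f.symm (ι u) = ι (f₁.symm u) := by
  rw [LinearEquiv.symm_apply_eq, hf, LinearEquiv.apply_symm_apply]

theorem comap_sup_of_semiconj {ι : U →ₗ[k] V} {D : Submodule k V} {f : V ≃ₗ[k] V}
    {f₁ : U ≃ₗ[k] U} (hf : ∀ u, f (ι u) = ι (f₁ u)) (hfD : ∀ v ∈ D, f v = v) (B : Submodule k U) :
    (B.map ι ⊔ D).comap (f : V →ₗ[k] V) = (B.comap (f₁ : U →ₗ[k] U)).map ι ⊔ D := by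
  rw [Submodule.comap_equiv_eq_map_symm, Submodule.comap_equiv_eq_map_symm]
  exact map_sup_of_semiconj (semiconj_symm hf) (symm_fixed hfD) B

theorem map_map_symm_of_semiconj {ι : U →ₗ[k] V} {f : V ≃ₗ[k] V} {f₁ : U ≃ₗ[k] U}
    (hf : ∀ u, f (ι u) = ι (f₁ u)) (l : List U) :
    (l.map ι).map f.symm = (l.map f₁.symm).map ι := by
  rw [List.map_map, List.map_map]
  exact List.map_congr_left fun u _ => semiconj_symm hf u

theorem index_eq_of_embedding {ι : U →ₗ[k] V} (hι : Function.Injective ι)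
    {D : Submodule k V} (hD : Disjoint (LinearMap.range ι) D) {A : Submodule k V}
    {A₁ : Submodule k U} (hA : A = A₁.map ι ⊔ D)
    {σ : ResGL A} {σ₁ : ResGL A₁} (hσ : ∀ u, σ.1 (ι u) = ι (σ₁.1 u))
    (hσD : ∀ v ∈ D, σ.1 v = v) : index A σ = index A₁ σ₁ := by
  subst hA
  obtain ⟨N, b, c, -, hb, hc, -⟩ := DetExt.exists_frames σ₁ σ₁
  have hc' := hc.map_sup hι hD
  rw [← map_sup_of_semiconj hσ hσD] at hc'
  rw [index_eq hb hc, index_eq (hb.map_sup hι hD) hc', List.length_map, List.length_map]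

/-- No homomorphism between the two extensions is needed. Lifts over V are pulled back to lifts over
U, and `comm_mul_apply` for both pairs gives the same identity of scalars, since σ and τ act on ιU
as σ₁ and τ₁ do on U and fix D pointwise. -/
theorem comm_eq_of_embedding {ι : U →ₗ[k] V} (hι : Function.Injective ι)
    {D : Submodule k V} (hD : Disjoint (LinearMap.range ι) D) {A : Submodule k V}
    {A₁ : Submodule k U} (hA : A = A₁.map ι ⊔ D)
    {σ τ : ResGL A} {σ₁ τ₁ : ResGL A₁} (h : Commute σ τ)
    (h₁ : Commute σ₁ τ₁) (hσ : ∀ u, σ.1 (ι u) = ι (σ₁.1 u)) (hτ : ∀ u, τ.1 (ι u) = ι (τ₁.1 u))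
    (hσD : ∀ v ∈ D, σ.1 v = v) (hτD : ∀ v ∈ D, τ.1 v = v) : comm A h = comm A₁ h₁ := by
  subst hA
  obtain ⟨x, rfl⟩ := exists_lift σ
  obtain ⟨y, rfl⟩ := exists_lift τ
  obtain ⟨N, b, c, c', d, hb, hc, hc', hd⟩ := DetExt.exists_frames_three σ₁ τ₁ (σ₁ * τ₁)
  have mσ := map_sup_of_semiconj hσ hσD
  have mτ := map_sup_of_semiconj hτ hτD
  let x₁ : DetExt A₁ := ⟨σ₁, x.det.pullback hι hD rfl (mσ A₁)⟩
  let y₁ : DetExt A₁ := ⟨τ₁, y.det.pullback hι hD rfl (mτ A₁)⟩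
  have hd₁ := hd
  rw [Subgroup.coe_mul, map_mul_eq] at hd₁
  -- The frame `d` is needed both as a frame of σ₁(τ₁A₁) and as one of τ₁(σ₁A₁), one for each order
  -- of multiplication.
  have hd₂ := hd
  rw [h₁.eq, Subgroup.coe_mul, map_mul_eq] at hd₂
  have hx₁ : ∀ {N c b}, IsFrame N (A₁.map (σ₁.1 : U →ₗ[k] U)) c → IsFrame N A₁ b →
      x₁.det.toFun N c b = x.det.toFun (N.map ι ⊔ D) (c.map ι) (b.map ι) :=
    fun hc hb => if_pos ⟨hc, hb⟩
  have hy₁ : ∀ {N c b}, IsFrame N (A₁.map (τ₁.1 : U →ₗ[k] U)) c → IsFrame N A₁ b →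
      y₁.det.toFun N c b = y.det.toFun (N.map ι ⊔ D) (c.map ι) (b.map ι) :=
    fun hc hb => if_pos ⟨hc, hb⟩
  have e₁ := comm_mul_apply h₁ (x := x₁) (y := y₁) rfl rfl hb hc hc' hd
  rw [hx₁ hc hb, hy₁ hc' hb, hx₁ ((isFrame_comap_iff _).2 hd₂) ((isFrame_comap_iff _).2 hc'),
    hy₁ ((isFrame_comap_iff _).2 hd₁) ((isFrame_comap_iff _).2 hc)] at e₁
  have e := comm_mul_apply h rfl rfl (hb.map_sup hι hD) (by rw [mσ]; exact hc.map_sup hι hD)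
    (by rw [mτ]; exact hc'.map_sup hι hD)
    (by rw [Subgroup.coe_mul, map_mul_eq, mτ, mσ]; exact hd₁.map_sup hι hD)
  rw [comap_sup_of_semiconj hσ hσD, comap_sup_of_semiconj hτ hτD, map_map_symm_of_semiconj hσ,
    map_map_symm_of_semiconj hσ, map_map_symm_of_semiconj hτ, map_map_symm_of_semiconj hτ,
    ← e₁] at e
  exact mul_right_cancel e

theorem tame_eq_of_embedding {ι : U →ₗ[k] V} (hι : Function.Injective ι)
    {D : Submodule k V} (hD : Disjoint (LinearMap.range ι) D) {A : Submodule k V}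
    {A₁ : Submodule k U} (hA : A = A₁.map ι ⊔ D)
    {σ τ : ResGL A} {σ₁ τ₁ : ResGL A₁} (h : Commute σ τ)
    (h₁ : Commute σ₁ τ₁) (hσ : ∀ u, σ.1 (ι u) = ι (σ₁.1 u)) (hτ : ∀ u, τ.1 (ι u) = ι (τ₁.1 u))
    (hσD : ∀ v ∈ D, σ.1 v = v) (hτD : ∀ v ∈ D, τ.1 v = v) : tame A h = tame A₁ h₁ := by
  rw [tame, tame, index_eq_of_embedding hι hD hA hσ hσD, index_eq_of_embedding hι hD hA hτ hτD,
    comm_eq_of_embedding hι hD hA h h₁ hσ hτ hσD hτD]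

end Embedding

/-! ### Diagonal automorphisms of a product, cut along subsets of the index set. -/

section Products

variable {k : Type u} [Field k] {I : Type w} {M : I → Type v} [∀ i, AddCommGroup (M i)]
  [∀ i, Module k (M i)] {P : ∀ i, Submodule k (M i)}

open Classical in
/-- The automorphism of `∏ M_i` acting by `f_i` on the factors with `i ∈ T` and trivially on the
others, as an element of `GL (∏ M_i, ∏ P_i)`. -/
noncomputable def partialGL (f : ∀ i, ResGL (P i))
    (hf : {i | (P i).map ((f i).1 : M i →ₗ[k] M i) ≠ P i}.Finite) (T : Set I) :
    ResGL (Submodule.pi Set.univ P) :=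
  ⟨LinearEquiv.piCongrRight fun i => (if i ∈ T then f i else 1 : ResGL (P i)).1, by
    rw [mem_ResGL, map_pi]
    refine commensurable_pi (fun i => (if i ∈ T then f i else 1 : ResGL (P i)).2) (hf.subset ?_)
    intro i hi
    by_cases hT : i ∈ T
    · simpa [hT] using hi
    · exact absurd (by simp [hT]) hi⟩

variable {f g : ∀ i, ResGL (P i)}
  {hf : {i | (P i).map ((f i).1 : M i →ₗ[k] M i) ≠ P i}.Finite}
  {hg : {i | (P i).map ((g i).1 : M i →ₗ[k] M i) ≠ P i}.Finite} {T T' : Set I}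

theorem partialGL_apply_of_mem {i : I} (hi : i ∈ T) (x : ∀ i, M i) :
    (partialGL f hf T).1 x i = (f i).1 (x i) := by
  simp [partialGL, hi]

theorem partialGL_apply_of_notMem {i : I} (hi : i ∉ T) (x : ∀ i, M i) :
    (partialGL f hf T).1 x i = x i := by
  simp [partialGL, hi]

theorem partialGL_union (h : Disjoint T T') :
    partialGL f hf (T ∪ T') = partialGL f hf T * partialGL f hf T' := by
  refine Subtype.ext (LinearEquiv.ext fun x => funext fun i => ?_)
  change _ = (partialGL f hf T).1 ((partialGL f hf T').1 x) i
  by_cases hi : i ∈ T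
  · rw [partialGL_apply_of_mem (Set.mem_union_left T' hi), partialGL_apply_of_mem hi,
      partialGL_apply_of_notMem (h.notMem_of_mem_left hi)]
  · rw [partialGL_apply_of_notMem hi]
    by_cases hi' : i ∈ T'
    · rw [partialGL_apply_of_mem (Set.mem_union_right T hi'), partialGL_apply_of_mem hi']
    · rw [partialGL_apply_of_notMem (by simp [hi, hi']), partialGL_apply_of_notMem hi']

theorem commute_partialGL (h : ∀ i, Commute (f i) (g i)) (hf hg) (T T' : Set I) :
    Commute (partialGL f hf T) (partialGL g hg T') := by
  refine Subtype.ext (LinearEquiv.ext fun x => funext fun i => ?_)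
  change (partialGL f hf T).1 ((partialGL g hg T').1 x) i =
    (partialGL g hg T').1 ((partialGL f hf T).1 x) i
  have h1 : (f i).1 ((g i).1 (x i)) = (g i).1 ((f i).1 (x i)) :=
    congrArg (fun e : ResGL (P i) => e.1 (x i)) (h i).eq
  by_cases hi : i ∈ T <;> by_cases hi' : i ∈ T' <;>
    simp [partialGL_apply_of_mem, partialGL_apply_of_notMem, hi, hi', h1]

theorem map_partialGL (hT : ∀ i ∈ T, (P i).map ((f i).1 : M i →ₗ[k] M i) = P i) :
    (Submodule.pi Set.univ P).map ((partialGL f hf T).1 : (∀ i, M i) →ₗ[k] ∀ i, M i) =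
      Submodule.pi Set.univ P := by
  rw [partialGL, map_pi]
  congr 1
  funext i
  by_cases hi : i ∈ T
  · simpa [hi] using hT i hi
  · simp [hi]

/-- The part of `∏ P_i` supported on `T`. -/
def piOn (P : ∀ i, Submodule k (M i)) (T : Set I) : Submodule k (∀ i, M i) :=
  Submodule.pi Set.univ P ⊓ Submodule.pi Tᶜ fun _ => ⊥

theorem mem_piOn {x : ∀ i, M i} :
    x ∈ piOn P T ↔ (∀ i, x i ∈ P i) ∧ ∀ i, i ∉ T → x i = 0 := by
  simp [piOn, Submodule.mem_pi]

theorem piOn_sup_piOn_compl (P : ∀ i, Submodule k (M i)) (T : Set I) :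
    Submodule.pi Set.univ P = piOn P T ⊔ piOn P Tᶜ := by
  classical
  refine le_antisymm (fun x hx => ?_) (sup_le inf_le_left inf_le_left)
  refine Submodule.mem_sup.2 ⟨fun i => if i ∈ T then x i else 0, mem_piOn.2 ⟨fun i => ?_, ?_⟩,
    fun i => if i ∈ T then 0 else x i, mem_piOn.2 ⟨fun i => ?_, ?_⟩, ?_⟩
  · split_ifs
    exacts [hx i trivial, zero_mem _]
  · intro i hi
    exact if_neg hi
  · split_ifs
    exacts [zero_mem _, hx i trivial]
  · intro i hi
    exact if_pos (not_not.1 hi)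
  · funext i
    by_cases hi : i ∈ T <;> simp [hi]

theorem disjoint_piOn (P : ∀ i, Submodule k (M i)) (h : Disjoint T T') :
    Disjoint (piOn P T) (piOn P T') := by
  refine Submodule.disjoint_def.2 fun x hx hx' => funext fun i => ?_
  by_cases hi : i ∈ T
  · exact (mem_piOn.1 hx').2 i (h.notMem_of_mem_left hi)
  · exact (mem_piOn.1 hx).2 i hi

/-- The family Q is left free: `comm_of_disjoint` needs all vectors supported on T' (Q = ⊤), the
reduction to one factor only the part of ∏ P_i (Q = P). -/
theorem partialGL_apply_of_mem_piOn (h : Disjoint T T') {Q : ∀ i, Submodule k (M i)} :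
    ∀ x ∈ piOn Q T', (partialGL f hf T).1 x = x := by
  intro x hx
  funext i
  by_cases hi : i ∈ T
  · rw [partialGL_apply_of_mem hi, (mem_piOn.1 hx).2 i (h.notMem_of_mem_left hi), map_zero]
  · exact partialGL_apply_of_notMem hi x

theorem map_piOn_le (hT : T ⊆ T') :
    (piOn P T').map ((partialGL f hf T).1 : (∀ i, M i) →ₗ[k] ∀ i, M i) ≤
      piOn (fun _ => ⊤) T' := by
  rintro _ ⟨x, hx, rfl⟩
  refine mem_piOn.2 ⟨fun i => trivial, fun i hi => ?_⟩
  exact (partialGL_apply_of_notMem (fun h => hi (hT h)) x).trans ((mem_piOn.1 hx).2 i hi)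

theorem commensurable_map_piOn (f : ∀ i, ResGL (P i)) (hf) (T T' : Set I) :
    Commensurable ((piOn P T').map ((partialGL f hf T).1 : (∀ i, M i) →ₗ[k] ∀ i, M i))
      (piOn P T') := by
  classical
  -- Written as a full product, with zero factors off T', the subspace falls under
  -- `commensurable_pi`.
  have e : piOn P T' = Submodule.pi Set.univ fun i => if i ∈ T' then P i else ⊥ := by
    ext x
    rw [mem_piOn, Submodule.mem_pi]
    constructor
    · intro hx i _
      split_ifs with hi
      exacts [hx.1 i, hx.2 i hi]
    · intro hx
      refine ⟨fun i => ?_, fun i hi => ?_⟩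
      · have := hx i trivial
        split_ifs at this with hi
        · exact this
        · rw [(Submodule.mem_bot k).1 this]
          exact zero_mem _
      · simpa [hi] using hx i trivial
  rw [e, partialGL, map_pi]
  refine commensurable_pi (fun i => ?_) (hf.subset fun i hi h => hi ?_)
  · by_cases hi : i ∈ T'
    · simp only [if_pos hi]
      exact (if i ∈ T then f i else 1 : ResGL (P i)).2
    · simpa only [if_neg hi, Submodule.map_bot] using Commensurable.refl _
  · by_cases hi' : i ∈ T'
    · by_cases hT : i ∈ T
      · simpa only [if_pos hi', if_pos hT] using h
      · simp only [if_pos hi', if_neg hT]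
        exact map_one_eq (P i)
    · simp only [if_neg hi', Submodule.map_bot]

/-- The independent parts are the vectors supported on T and those supported on its complement,
which contains T'. -/
theorem comm_partialGL_of_disjoint (hT : Disjoint T T')
    (h : Commute (partialGL f hf T) (partialGL g hg T')) :
    comm (Submodule.pi Set.univ P) h = (-1) ^ (index (Submodule.pi Set.univ P) (partialGL f hf T) *
      index (Submodule.pi Set.univ P) (partialGL g hg T')) := by
  have hle : ∀ S : Set I, piOn P S ≤ piOn (fun _ => ⊤) S := fun S x hx =>
    mem_piOn.2 ⟨fun _ => trivial, (mem_piOn.1 hx).2⟩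
  exact comm_of_disjoint (piOn_sup_piOn_compl P T)
    (disjoint_piOn (fun _ => ⊤) disjoint_compl_right) (hle T) (hle Tᶜ) h
    (map_piOn_le subset_rfl) (map_piOn_le hT.subset_compl_left)
    (partialGL_apply_of_mem_piOn disjoint_compl_right) (partialGL_apply_of_mem_piOn hT.symm)
    (commensurable_map_piOn f hf T T) (commensurable_map_piOn g hg T' Tᶜ)

theorem tame_partialGL_union (h : ∀ i, Commute (f i) (g i)) (hf hg) (hT : Disjoint T T') :
    tame _ (commute_partialGL h hf hg (T ∪ T') (T ∪ T')) =
      tame _ (commute_partialGL h hf hg T T) * tame _ (commute_partialGL h hf hg T' T') :=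
  tame_mul_mul _ _ (commute_partialGL h hf hg T T') (commute_partialGL h hf hg T' T)
    (partialGL_union hT) (partialGL_union hT) _ (comm_partialGL_of_disjoint hT _)
    (comm_partialGL_of_disjoint hT.symm _)

/-- Here M_i is embedded as the i-th coordinate axis, and the trivial summand D is the part of ∏ P_j
supported away from i. -/
theorem tame_partialGL_singleton (h : ∀ i, Commute (f i) (g i)) (hf hg) (i : I) :
    tame _ (commute_partialGL h hf hg {i} {i}) = tame (P i) (h i) := by
  classical
  have key : ∀ {f : ∀ i, ResGL (P i)} (hf) (u : M i),
      (partialGL f hf {i}).1 (LinearMap.single k M i u) = LinearMap.single k M i ((f i).1 u) := by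
    intro f hf u
    funext j
    by_cases hj : j = i
    · subst hj
      rw [partialGL_apply_of_mem (Set.mem_singleton j)]
      simp
    · rw [partialGL_apply_of_notMem (by simpa using hj)]
      simp [hj]
  have hmap : (P i).map (LinearMap.single k M i) = piOn P {i} := by
    ext x
    rw [mem_piOn]
    constructor
    · rintro ⟨u, hu, rfl⟩
      refine ⟨fun j => ?_, fun j hj => by simp at hj; simp [hj]⟩
      by_cases hj : j = i
      · subst hj; simpa using hu
      · simp [hj]
    · intro hx
      refine ⟨x i, hx.1 i, funext fun j => ?_⟩
      by_cases hj : j = i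
      · subst hj; simp
      · simp [hj, hx.2 j hj]
  refine tame_eq_of_embedding (ι := LinearMap.single k M i) (D := piOn P {i}ᶜ)
    (Pi.single_injective i) ?_ ?_ _ _ (key hf) (key hg)
    (partialGL_apply_of_mem_piOn disjoint_compl_right)
    (partialGL_apply_of_mem_piOn disjoint_compl_right)
  · refine Submodule.disjoint_def.2 ?_
    rintro _ ⟨u, rfl⟩ hx
    have := (mem_piOn.1 hx).2 i (by simp)
    have hu : u = 0 := by simpa using this
    rw [hu, map_zero]
  · rw [hmap]
    exact piOn_sup_piOn_compl P {i}

theorem tame_partialGL_eq_one (h : ∀ i, Commute (f i) (g i)) (hf hg)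
    (hT : ∀ i ∈ T, (P i).map ((f i).1 : M i →ₗ[k] M i) = P i)
    (hT' : ∀ i ∈ T, (P i).map ((g i).1 : M i →ₗ[k] M i) = P i) :
    tame _ (commute_partialGL h hf hg T T) = 1 :=
  tame_eq_one _ (map_partialGL hT) (map_partialGL hT')

theorem tame_partialGL_finset (h : ∀ i, Commute (f i) (g i)) (hf hg) (S : Finset I) :
    tame _ (commute_partialGL h hf hg S S) = ∏ i ∈ S, tame (P i) (h i) := by
  classical
  induction S using Finset.induction_on with
  | empty => exact tame_partialGL_eq_one h hf hg (by simp) (by simp)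
  | insert i S hi ih =>
    rw [Finset.prod_insert hi, ← ih, ← tame_partialGL_singleton h hf hg i]
    have := tame_partialGL_union h hf hg (T := {i}) (T' := S) (by simpa using hi)
    convert this using 2 <;> simp

/-- The tame symbol of two commuting diagonal automorphisms of `∏ M_i` is the product of the
local tame symbols. -/
theorem tame_pi (h : ∀ i, Commute (f i) (g i))
    (hf : {i | (P i).map ((f i).1 : M i →ₗ[k] M i) ≠ P i}.Finite)
    (hg : {i | (P i).map ((g i).1 : M i →ₗ[k] M i) ≠ P i}.Finite)
    {σ τ : ResGL (Submodule.pi Set.univ P)}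
    (hστ : Commute σ τ)
    (hσ : ∀ x i, σ.1 x i = (f i).1 (x i))
    (hτ : ∀ x i, τ.1 x i = (g i).1 (x i)) {S : Finset I}
    (hS : ∀ i ∉ S, (P i).map ((f i).1 : M i →ₗ[k] M i) = P i)
    (hS' : ∀ i ∉ S, (P i).map ((g i).1 : M i →ₗ[k] M i) = P i) :
    tame _ hστ = ∏ i ∈ S, tame (P i) (h i) := by
  -- Taking all of I in the form S ∪ Sᶜ lets the symbol split at once into a finite product and a
  -- part preserving ∏ P_i.
  have eσ : σ = partialGL f hf (S ∪ (S : Set I)ᶜ) :=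
    Subtype.ext (LinearEquiv.ext fun x => funext fun i =>
      (hσ x i).trans (partialGL_apply_of_mem (by simp) x).symm)
  have eτ : τ = partialGL g hg (S ∪ (S : Set I)ᶜ) :=
    Subtype.ext (LinearEquiv.ext fun x => funext fun i =>
      (hτ x i).trans (partialGL_apply_of_mem (by simp) x).symm)
  subst eσ eτ
  rw [tame_partialGL_union h hf hg disjoint_compl_right, tame_partialGL_finset h hf hg S,
    tame_partialGL_eq_one h hf hg (by simpa using hS) (by simpa using hS'), mul_one]

end Products

end TameSymbol

/-! ### The product formula. -/

theorem mainTheorem6 {k : Type*} [Field k] {V : Type*} [AddCommGroup V] [Module k V] {I : Type*}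
    (A W : I → Submodule k V) (hAW : ∀ i, A i ≤ W i)
    (hW : ∀ σ ∈ TameSymbol.FamGL A, ∀ i, (W i).map (σ : V →ₗ[k] V) = W i)
    (σ τ : TameSymbol.FamGL A) (hστ : Commute σ τ)
    {G : Type*} [CommGroup G] (φ : kˣ →* G) :
    let σloc := fun i => TameSymbol.localHom A W hAW hW i σ
    let τloc := fun i => TameSymbol.localHom A W hAW hW i τ
    let term : I → G := fun i =>
      φ (-1) ^ (TameSymbol.index ((A i).submoduleOf (W i)) (σloc i) *
          TameSymbol.index ((A i).submoduleOf (W i)) (τloc i)) *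
        TameSymbol.commPush ((A i).submoduleOf (W i)) φ
          (hστ.map (TameSymbol.localHom A W hAW hW i))
    let glob := TameSymbol.globalHom A W hAW hW
    {i | term i ≠ 1}.Finite ∧
      φ (TameSymbol.tame (TameSymbol.prodSub A W) (hστ.map glob)) = ∏ᶠ i, term i ∧
      (TameSymbol.comm (TameSymbol.prodSub A W) (hστ.map glob) = 1 →
        TameSymbol.index (TameSymbol.prodSub A W) (glob σ) = 0 → ∏ᶠ i, term i = 1) := by
  intro σloc τloc term glob
  have hloc := fun i => hστ.map (TameSymbol.localHom A W hAW hW i)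
  have hterm : ∀ i, term i = φ (TameSymbol.tame ((A i).submoduleOf (W i)) (hloc i)) := fun i => by
    rw [TameSymbol.tame, map_mul, map_zpow, ← TameSymbol.commPush_eq]
  have hmap : ∀ (ρ : TameSymbol.FamGL A) i, (A i).map (ρ.1 : V →ₗ[k] V) = A i →
      ((A i).submoduleOf (W i)).map
        ((TameSymbol.localHom A W hAW hW i ρ).1 : W i →ₗ[k] W i) = (A i).submoduleOf (W i) :=
    fun ρ i h => by
      refine (TameSymbol.map_restrict (hAW i) (hW ρ.1 ρ.2 i)).trans ?_
      rw [h]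
  have hfin : ∀ ρ : TameSymbol.FamGL A, {i | ((A i).submoduleOf (W i)).map
      ((TameSymbol.localHom A W hAW hW i ρ).1 : W i →ₗ[k] W i) ≠ (A i).submoduleOf (W i)}.Finite :=
    fun ρ => ρ.2.2.subset fun i hi h => hi (hmap ρ i h)
  -- The exceptional set: outside it both σ and τ preserve V_i, so the local symbol is 1 and the
  -- product over I reduces to this finite set.
  have hu := (hfin σ).union (hfin τ)
  have hS : ∀ i ∉ hu.toFinset, _ ∧ _ := fun i hi => by
    rwa [Set.Finite.mem_toFinset, Set.mem_union, not_or, Set.mem_ofPred_eq, Set.mem_ofPred_eq,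
      not_not, not_not] at hi
  have hone : ∀ i ∉ hu.toFinset, term i = 1 := fun i hi => by
    rw [hterm, TameSymbol.tame_eq_one (hloc i) (hS i hi).1 (hS i hi).2, map_one]
  have hprod : φ (TameSymbol.tame (TameSymbol.prodSub A W) (hστ.map glob)) = ∏ᶠ i, term i := by
    -- The global action is by definition the local one in each coordinate.
    have h := TameSymbol.tame_pi hloc (hfin σ) (hfin τ) (hστ.map glob) (fun _ _ => rfl)
      (fun _ _ => rfl) (fun i hi => (hS i hi).1) (fun i hi => (hS i hi).2)
    rw [finprod_eq_prod_of_mulSupport_subset term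
      (fun i hi => by_contra fun h => hi (hone i h))]
    refine (congrArg φ h).trans ((map_prod _ _ _).trans ?_)
    exact Finset.prod_congr rfl fun i _ => (hterm i).symm
  refine ⟨hu.toFinset.finite_toSet.subset fun i hi => by_contra fun h => hi (hone i h), hprod,
    fun hc hi => ?_⟩
  -- Vanishing of the index of σ alone already kills the sign, since the exponent is a product.
  rw [← hprod, TameSymbol.tame, hc, hi, zero_mul, zpow_zero, mul_one, map_one]
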